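/- Let $N\ge 2$ be an integer and $\alpha\ge 1$. Let $\Omega_N=\{x=(x_1,\dots,x_{N-1})\in\mathbb{R}^{N-1}:0\le x_1\le\dots\le x_{N-1}\le N\}$, with the conventions $x_0=0$, $x_N=N$, and let $\pi_{N,\alpha}$ be the probability measure on $\Omega_N$ with density $$\frac{\Gamma(N\alpha)}{\Gamma(\alpha)^N N^{N\alpha-1}}\prod_{i=1}^N(x_i-x_{i-1})^{\alpha-1}$$ with respect to Lebesgue measure. Let $\mathcal{S}_N$ be the set of probability measures $\mu$ on $\Omega_N$ that are absolutely continuous with respect to $\pi_{N,\alpha}$ with a density (with values in $[0,\infty]$) that is increasing for the coordinate order on $\Omega_N$. For an integer $K\ge 1$ set $u_i=\lfloor iN/K\rfloor$, $i=1,\dots,K-1$ (the labels of the special particles), let $W=\sum_{i=1}^{K-1}(x_{u_i}-u_i)$, and write $\bar\mu$ for the law of $(x_{u_1},\dots,x_{u_{K-1}})$ under a probability measure $\mu$ on $\Omega_N$. Let $\|\mu-\nu\|_{TV}=\sup_B(\mu(B)-\nu(B))$, the supremum being over Borel sets $B$. **Proposition 6.6.** Fix $\alpha\ge 1$. For every $\varepsilon>0$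 and every integer $K\ge 1$ there exists $\eta=\eta(\alpha,K,\varepsilon)>0$ such that for all $N\ge 2$ and all $\mu\in\mathcal{S}_N$, $$\int W\,d\mu\le\eta\sqrt N\quad\Longrightarrow\quad\|\bar\mu-\bar\pi_{N,\alpha}\|_{TV}\le\varepsilon .$$ -/

import Mathlib

open MeasureTheory

namespace SimplexWalk

noncomputable section

/-- The position `x_k`, `0 ≤ k ≤ N`, of a configuration `x = (x_1, …, x_{N-1})`, with the
conventions `x_0 = 0` and `x_N = N`. The coordinate `x_k` is stored at index `k - 1`. -/
def position (N : ℕ) (x : Fin (N - 1) → ℝ) (k : ℕ) : ℝ :=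
  if k = 0 then 0 else if h : k - 1 < N - 1 then x ⟨k - 1, h⟩ else (N : ℝ)

/-- The set `Ω_N` of configurations with `0 = x_0 ≤ x_1 ≤ ⋯ ≤ x_{N-1} ≤ x_N = N`. -/
def Omega (N : ℕ) : Set (Fin (N - 1) → ℝ) :=
  {x | ∀ i ∈ Finset.Icc 1 N, position N x (i - 1) ≤ position N x i}

/-- The density with respect to Lebesgue measure on `Ω_N` of the equilibrium distribution. -/
def equilibriumDensity (N : ℕ) (α : ℝ) (x : Fin (N - 1) → ℝ) : ℝ :=
  Real.Gamma (N * α) / (Real.Gamma α ^ N * (N : ℝ) ^ (N * α - 1)) *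
    ∏ i ∈ Finset.Icc 1 N, (position N x i - position N x (i - 1)) ^ (α - 1)

/-- The equilibrium distribution `π_{N,α}`, as a measure on `ℝ^{N-1}` carried by `Ω_N`. -/
def equilibrium (N : ℕ) (α : ℝ) : Measure (Fin (N - 1) → ℝ) :=
  (volume.restrict (Omega N)).withDensity fun x => ENNReal.ofReal (equilibriumDensity N α x)

/-- The set `𝓢_N` of probability measures having a density with respect to `π_{N,α}` that is
increasing on `Ω_N` for the coordinate order. The density may be infinite on a null set: an
increasing density that blows up at the boundary has no finite increasing version on the closed
set `Ω_N`. -/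
def IncreasingDensity (N : ℕ) (α : ℝ) : Set (Measure (Fin (N - 1) → ℝ)) :=
  {μ | IsProbabilityMeasure μ ∧ ∃ φ : (Fin (N - 1) → ℝ) → ENNReal,
    AEMeasurable φ (equilibrium N α) ∧ MonotoneOn φ (Omega N) ∧
      μ = (equilibrium N α).withDensity φ}

/-- The label `u_i = ⌊i N / K⌋` of the `i`-th special particle. -/
def specialLabel (N K i : ℕ) : ℕ := i * N / K

/-- The positions `y = (y_1, …, y_{K-1})`, `y_i = x_{u_i}`, of the special particles. -/
def specialPositions (N K : ℕ) (x : Fin (N - 1) → ℝ) : Fin (K - 1) → ℝ :=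
  fun i => position N x (specialLabel N K (i + 1))

/-- The marginal of `μ` on the positions of the special particles. -/
def specialMarginal (N K : ℕ) (μ : Measure (Fin (N - 1) → ℝ)) : Measure (Fin (K - 1) → ℝ) :=
  μ.map (specialPositions N K)

/-- The sum `W = ∑_{i=1}^{K-1} (x_{u_i} - u_i)` of the centred heights of the special
particles. -/
def specialHeight (N K : ℕ) (x : Fin (N - 1) → ℝ) : ℝ :=
  ∑ i ∈ Finset.Icc 1 (K - 1), (position N x (specialLabel N K i) - (specialLabel N K i : ℝ))

/-- The total variation distance `sup_B (μ(B) - ν(B))` of two probability measures, the supremum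
being over all measurable sets `B`. -/
def tvDist {E : Type*} [MeasurableSpace E] (μ ν : Measure E) : ℝ :=
  ⨆ B : {B : Set E // MeasurableSet B}, (μ.real B.1 - ν.real B.1)

end

end SimplexWalk

namespace SimplexWalk

open ProbabilityTheory

/-! Rescaling by `1/N` turns `equilibrium` into the symmetric Dirichlet law `simplexLaw` and `μ`
into a law with increasing density `f`. The result rests on a covariance inequality,
`CovarianceBound`: for `F ≥ 0` bounded and increasing and `g` a `[0,1]`-valued function of the
labelled points, `Cov(F, g) ≤ A Cov(F, height) + B E[F]`, where `A` is of order `√N` and `B` is as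
small as desired. Take for `F` truncations of `f` and for `g` an indicator. In the limit the left
side is a difference of probabilities, while `Cov(f, height) = N⁻¹ ∫ W dμ ≤ η / √N`, so the right
side is small (`CovarianceBound.real_sub_le`).

The inequality is proved by induction on the number of labels (`CovarianceBound.split`). The
position `b` of the last label has a beta law, and the rescaled configurations below and above it
are independent of `b` and of each other, again Dirichlet. The points above are averaged out. Write
`F₂(b)` for the conditional mean of `F` and `C(b)` for its conditional covariance with the height of
the lower labels. Then `Cov(F, height)` is the sum of `E[b C(b)]` and a multiple of `Cov(F₂, b)`,
and neither term is negative. Likewise `Cov(F, g)` is the mean of a conditional covariance, bounded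
through the induction by `A C(b) + B F₂(b)`, plus the covariance of `F₂` with a function of `b`
valued in `[0,1]`.

The missing factor `b` costs `1/c` where `b ≥ c`; the event `b < c` is rare, and the increasing `F₂`
gives it no more than its share (`integral_mul_indicator_Iio_le`). The last covariance is at most
the `L¹` distance of `F₂` to a constant, which for increasing functions is at most `(3/d) Cov(F₂,
b)`, with `d` comparable to the mean absolute deviation of `b` (`integral_abs_sub_le_of_monotone`).
Distinct consecutive labels are at least `N/(2K)` apart, so `c` can be fixed and `d` taken of order
`N^{-1/2}`. -/

/-! ### Moments and mean absolute deviation of beta laws. -/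

theorem betaPDFReal_nonneg {s t : ℝ} (hs : 0 < s) (ht : 0 < t) (x : ℝ) :
    0 ≤ betaPDFReal s t x := by
  by_cases h : 0 < x ∧ x < 1
  · exact (betaPDFReal_pos h.1 h.2 hs ht).le
  · simp [betaPDFReal, h]

theorem integral_betaMeasure {s t : ℝ} (hs : 0 < s) (ht : 0 < t) (f : ℝ → ℝ) :
    ∫ x, f x ∂betaMeasure s t = ∫ x, betaPDFReal s t x * f x := by
  rw [betaMeasure, integral_withDensity_eq_integral_toReal_smul
    (by unfold betaPDF; fun_prop) (by simp [betaPDF])]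
  simp [betaPDF, ENNReal.toReal_ofReal (betaPDFReal_nonneg hs ht _)]

theorem beta_add_one_left {s t : ℝ} (hs : 0 < s) (ht : 0 < t) :
    beta (s + 1) t = s / (s + t) * beta s t := by
  have h1 : s + t ≠ 0 := by positivity
  have h2 : Real.Gamma (s + t) ≠ 0 := (Real.Gamma_pos_of_pos (by positivity)).ne'
  rw [beta, beta, Real.Gamma_add_one hs.ne', show s + 1 + t = (s + t) + 1 by ring,
    Real.Gamma_add_one h1]
  field_simp

theorem mul_betaPDFReal {s t : ℝ} (hs : 0 < s) (ht : 0 < t) (x : ℝ) :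
    betaPDFReal s t x * x = s / (s + t) * betaPDFReal (s + 1) t x := by
  unfold betaPDFReal
  split_ifs with h
  · have h1 : beta s t ≠ 0 := (beta_pos hs ht).ne'
    have h2 : s + t ≠ 0 := by positivity
    rw [beta_add_one_left hs ht, show s + 1 - 1 = (s - 1) + 1 by ring,
      Real.rpow_add_one h.1.ne']
    field_simp
  · simp

/-- Size-biasing raises the first beta parameter by one; iterating it yields all the moments below.
-/
theorem integral_mul_id_betaMeasure {s t : ℝ} (hs : 0 < s) (ht : 0 < t) (f : ℝ → ℝ) :
    ∫ x, x * f x ∂betaMeasure s t = s / (s + t) * ∫ x, f x ∂betaMeasure (s + 1) t := by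
  rw [integral_betaMeasure hs ht, integral_betaMeasure (by positivity) ht, ← integral_const_mul]
  congr 1 with x
  rw [← mul_assoc, mul_betaPDFReal hs ht, mul_assoc]

theorem ae_mem_Ioo_betaMeasure (s t : ℝ) :
    ∀ᵐ x ∂betaMeasure s t, x ∈ Set.Ioo (0 : ℝ) 1 := by
  rw [betaMeasure, ae_withDensity_iff (by unfold betaPDF; fun_prop)]
  refine Filter.Eventually.of_forall fun x hx => ?_
  by_contra h
  apply hx
  simp only [Set.mem_Ioo] at h
  simp [betaPDF, betaPDFReal, h]

theorem integral_id_betaMeasure {s t : ℝ} (hs : 0 < s) (ht : 0 < t) :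
    ∫ x, x ∂betaMeasure s t = s / (s + t) := by
  have : IsProbabilityMeasure (betaMeasure (s + 1) t) :=
    isProbabilityMeasureBeta (by positivity) ht
  simpa using integral_mul_id_betaMeasure hs ht (fun _ => 1)

theorem integral_pow_two_betaMeasure {s t : ℝ} (hs : 0 < s) (ht : 0 < t) :
    ∫ x, x ^ 2 ∂betaMeasure s t = s / (s + t) * ((s + 1) / (s + 1 + t)) := by
  rw [← integral_id_betaMeasure (s := s + 1) (by positivity) ht,
    ← integral_mul_id_betaMeasure hs ht]
  simp only [sq]

theorem integral_pow_three_betaMeasure {s t : ℝ} (hs : 0 < s) (ht : 0 < t) :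
    ∫ x, x ^ 3 ∂betaMeasure s t =
      s / (s + t) * ((s + 1) / (s + 1 + t) * ((s + 1 + 1) / (s + 1 + 1 + t))) := by
  rw [← integral_pow_two_betaMeasure (by positivity) ht, ← integral_mul_id_betaMeasure hs ht]
  congr 1 with x; ring

theorem integral_pow_four_betaMeasure {s t : ℝ} (hs : 0 < s) (ht : 0 < t) :
    ∫ x, x ^ 4 ∂betaMeasure s t =
      s / (s + t) * ((s + 1) / (s + 1 + t) * ((s + 1 + 1) / (s + 1 + 1 + t) *
        ((s + 1 + 1 + 1) / (s + 1 + 1 + 1 + t)))) := by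
  rw [← integral_pow_three_betaMeasure (by positivity) ht, ← integral_mul_id_betaMeasure hs ht]
  congr 1 with x; ring

theorem integrable_of_continuous_betaMeasure {s t : ℝ} (hs : 0 < s) (ht : 0 < t) {f : ℝ → ℝ}
    (hf : Continuous f) : Integrable f (betaMeasure s t) := by
  have : IsProbabilityMeasure (betaMeasure s t) := isProbabilityMeasureBeta hs ht
  obtain ⟨C, hC⟩ := (isCompact_Icc (a := (0 : ℝ)) (b := 1)).exists_bound_of_continuousOn
    hf.continuousOn
  refine Integrable.of_bound hf.aestronglyMeasurable C ?_
  filter_upwards [ae_mem_Ioo_betaMeasure s t] with x hx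
  exact hC x ⟨hx.1.le, hx.2.le⟩

theorem variance_betaMeasure {s t : ℝ} (hs : 0 < s) (ht : 0 < t) :
    ∫ x, (x - s / (s + t)) ^ 2 ∂betaMeasure s t =
      s * t / ((s + t) ^ 2 * (s + t + 1)) := by
  have : IsProbabilityMeasure (betaMeasure s t) := isProbabilityMeasureBeta hs ht
  have e : ∀ x : ℝ, (x - s / (s + t)) ^ 2 =
      x ^ 2 + (-2 * (s / (s + t))) * x + (s / (s + t)) ^ 2 := fun x => by ring
  simp only [e]
  rw [integral_add (integrable_of_continuous_betaMeasure hs ht (by fun_prop)) (by simp),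
    integral_add (integrable_of_continuous_betaMeasure hs ht (by fun_prop))
      (integrable_of_continuous_betaMeasure hs ht (by fun_prop)),
    integral_const_mul, integral_id_betaMeasure hs ht, integral_pow_two_betaMeasure hs ht]
  have h1 : s + t ≠ 0 := by positivity
  have h2 : s + t + 1 ≠ 0 := by positivity
  rw [show s + 1 + t = s + t + 1 by ring]
  simp
  field_simp
  ring

theorem fourthMoment_betaMeasure {s t : ℝ} (hs : 0 < s) (ht : 0 < t) :
    ∫ x, (x - s / (s + t)) ^ 4 ∂betaMeasure s t =
      3 * s * t * (2 * (s + t) ^ 2 + s * t * (s + t - 6)) /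
        ((s + t) ^ 4 * (s + t + 1) * (s + t + 2) * (s + t + 3)) := by
  have : IsProbabilityMeasure (betaMeasure s t) := isProbabilityMeasureBeta hs ht
  have e : ∀ x : ℝ, (x - s / (s + t)) ^ 4 =
      x ^ 4 + (-4 * (s / (s + t))) * x ^ 3 + (6 * (s / (s + t)) ^ 2) * x ^ 2 +
        (-4 * (s / (s + t)) ^ 3) * x + (s / (s + t)) ^ 4 := fun x => by ring
  simp only [e]
  have hi : ∀ {f : ℝ → ℝ}, Continuous f → Integrable f (betaMeasure s t) :=
    fun hf => integrable_of_continuous_betaMeasure hs ht hf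
  rw [integral_add (hi (by fun_prop)) (by simp),
    integral_add (hi (by fun_prop)) (hi (by fun_prop)),
    integral_add (hi (by fun_prop)) (hi (by fun_prop)),
    integral_add (hi (by fun_prop)) (hi (by fun_prop)),
    integral_const_mul, integral_const_mul, integral_const_mul, integral_id_betaMeasure hs ht,
    integral_pow_two_betaMeasure hs ht, integral_pow_three_betaMeasure hs ht,
    integral_pow_four_betaMeasure hs ht]
  have h1 : s + t ≠ 0 := by positivity
  have h2 : s + t + 1 ≠ 0 := by positivity
  have h3 : s + t + 2 ≠ 0 := by positivity
  have h4 : s + t + 3 ≠ 0 := by positivity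
  rw [show s + 1 + t = s + t + 1 by ring, show s + 1 + 1 + t = s + t + 2 by ring,
    show s + 1 + 1 + 1 + t = s + t + 3 by ring]
  simp
  field_simp
  ring

/-- As `s t ≤ (s + t)² / 4`, the numerator of the exact formula is at most of degree five in `s +
t`, against degree seven below. -/
theorem fourthMoment_betaMeasure_le {s t : ℝ} (hs : 1 ≤ s) (ht : 1 ≤ t) :
    ∫ x, (x - s / (s + t)) ^ 4 ∂betaMeasure s t ≤ 2 / (s + t) ^ 2 := by
  rw [fourthMoment_betaMeasure (by positivity) (by positivity), div_le_div_iff₀ (by positivity)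
    (by positivity)]
  have hp : 0 ≤ s * t := by positivity
  have hst : s * t ≤ (s + t) ^ 2 / 4 := by nlinarith [sq_nonneg (s - t)]
  have hS : 2 ≤ s + t := by linarith
  generalize s + t = S at *
  generalize hP : s * t = P at *
  have hS0 : (0 : ℝ) < S := by linarith
  have h1 : 3 * s * t * (2 * S ^ 2 + P * (S - 6)) ≤ 3 / 4 * S ^ 2 * (2 * S ^ 2 + S ^ 2 / 4 * S) := by
    rw [show 3 * s * t = 3 * P by rw [← hP]; ring]
    have : 2 * S ^ 2 + P * (S - 6) ≤ 2 * S ^ 2 + S ^ 2 / 4 * S := by nlinarith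
    calc 3 * P * (2 * S ^ 2 + P * (S - 6)) ≤ 3 * P * (2 * S ^ 2 + S ^ 2 / 4 * S) := by gcongr
      _ ≤ _ := by
        have : 3 * P ≤ 3 / 4 * S ^ 2 := by linarith
        gcongr
  calc 3 * s * t * (2 * S ^ 2 + P * (S - 6)) * S ^ 2
      ≤ 3 / 4 * S ^ 2 * (2 * S ^ 2 + S ^ 2 / 4 * S) * S ^ 2 := by gcongr
    _ ≤ 2 * (S ^ 4 * S * S * S) := by
      have : 0 ≤ S ^ 6 * (S - 2) := by have := sub_nonneg.2 hS; positivity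
      nlinarith [pow_pos hS0 6, pow_pos hS0 7]
    _ ≤ 2 * (S ^ 4 * (S + 1) * (S + 2) * (S + 3)) := by gcongr <;> linarith

/-- Lower bound on the first absolute central moment from the second and fourth ones. -/
theorem integral_abs_sub_betaMeasure_ge {s t r : ℝ} (hs : 1 ≤ s) (ht : 1 ≤ t) (hr : 0 < r)
    (hrs : r * (s + t) ≤ s) (hrt : r * (s + t) ≤ t) :
    r ^ 3 / (12 * Real.sqrt (s + t)) ≤ ∫ x, |x - s / (s + t)| ∂betaMeasure s t := by
  have hs0 : 0 < s := by positivity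
  have ht0 : 0 < t := by positivity
  have hi : ∀ {f : ℝ → ℝ}, Continuous f → Integrable f (betaMeasure s t) :=
    fun hf => integrable_of_continuous_betaMeasure hs0 ht0 hf
  have h2 := variance_betaMeasure hs0 ht0
  have h4 := fourthMoment_betaMeasure_le hs ht
  set m := s / (s + t)
  set S := s + t with hS
  have hS1 : 1 ≤ S := by linarith
  have hS0 : 0 < S := by linarith
  set q := Real.sqrt S with hq
  have hq0 : 0 < q := Real.sqrt_pos.2 hS0
  have hqS : q ^ 2 = S := Real.sq_sqrt hS0.le
  -- This scale makes the fourth-moment term at most `2r²/(9S)`, below the variance bound `r²/(2S)`.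
  set l := 3 / (r * q) with hl
  have hl0 : 0 < l := by positivity
  -- With `|x - m| = l z` this is `z² - z⁴ ≤ z`.
  have hpt : ∀ x : ℝ, (x - m) ^ 2 - (1 / l ^ 2) * (x - m) ^ 4 ≤ l * |x - m| := by
    intro x
    rw [← sq_abs, show (x - m) ^ 4 = |x - m| ^ 4 by rw [Even.pow_abs (by decide)]]
    have hy : 0 ≤ |x - m| := abs_nonneg _
    generalize |x - m| = y at *
    obtain ⟨z, rfl⟩ : ∃ z, y = l * z := ⟨y / l, by field_simp⟩
    have hz : 0 ≤ z := nonneg_of_mul_nonneg_right hy hl0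
    have e : (l * z) ^ 2 - 1 / l ^ 2 * (l * z) ^ 4 = l ^ 2 * (z ^ 2 - z ^ 4) := by
      field_simp
    rw [e, show l * (l * z) = l ^ 2 * z by ring]
    gcongr
    rcases le_total z 1 with h | h
    · nlinarith [pow_nonneg hz 4]
    · nlinarith [pow_le_pow_right₀ h (show 2 ≤ 4 by norm_num)]
  have hint : (∫ x, (x - m) ^ 2 ∂betaMeasure s t) - (1 / l ^ 2) * ∫ x, (x - m) ^ 4 ∂betaMeasure s t
      ≤ l * ∫ x, |x - m| ∂betaMeasure s t := by
    rw [← integral_const_mul, ← integral_const_mul, ← integral_sub (hi (by fun_prop))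
      (hi (by fun_prop))]
    exact integral_mono (hi (by fun_prop)) (hi (by fun_prop)) hpt
  have hv : r ^ 2 / (2 * S) ≤ ∫ x, (x - m) ^ 2 ∂betaMeasure s t := by
    rw [h2, div_le_div_iff₀ (by positivity) (by positivity)]
    have : (r * S) * (r * S) ≤ s * t := by gcongr
    calc r ^ 2 * (S ^ 2 * (S + 1)) = ((r * S) * (r * S)) * (S + 1) := by ring
      _ ≤ (s * t) * (2 * S) := by
        gcongr
        linarith
  have h5 : (1 / l ^ 2) * ∫ x, (x - m) ^ 4 ∂betaMeasure s t ≤ 2 * r ^ 2 / (9 * S) := by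
    calc _ ≤ (1 / l ^ 2) * (2 / S ^ 2) := by gcongr
      _ = 2 * r ^ 2 / (9 * S) := by
        rw [hl, ← hqS]
        field_simp
        norm_num
  have h6 : 5 * r ^ 2 / (18 * S) ≤ l * ∫ x, |x - m| ∂betaMeasure s t := by
    have : 5 * r ^ 2 / (18 * S) = r ^ 2 / (2 * S) - 2 * r ^ 2 / (9 * S) := by
      field_simp
      norm_num
    linarith
  have h7 : 5 * r ^ 2 / (18 * S) / l = 5 * r ^ 3 / (54 * q) := by
    rw [hl, ← hqS]
    field_simp
    norm_num
  calc r ^ 3 / (12 * q) ≤ 5 * r ^ 3 / (54 * q) := by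
        rw [div_le_div_iff₀ (by positivity) (by positivity)]
        have : 0 < r ^ 3 * q := by positivity
        nlinarith
    _ = 5 * r ^ 2 / (18 * S) / l := h7.symm
    _ ≤ _ := by
      rw [div_le_iff₀ hl0]
      linarith

/-! ### Mass of a beta law near zero. -/

theorem sqrt_mul_betaPDFReal {s t : ℝ} (hs : 0 < s) (ht : 0 < t) (x : ℝ) :
    betaPDFReal s t x * Real.sqrt x =
      beta (s + 1 / 2) t / beta s t * betaPDFReal (s + 1 / 2) t x := by
  unfold betaPDFReal
  split_ifs with h
  · have h1 : beta s t ≠ 0 := (beta_pos hs ht).ne'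
    have h2 : beta (s + 1 / 2) t ≠ 0 := (beta_pos (by positivity) ht).ne'
    rw [show s + 1 / 2 - 1 = (s - 1) + 1 / 2 by ring, Real.rpow_add h.1, Real.sqrt_eq_rpow]
    generalize beta (s + 1 / 2) t = B at *
    field_simp
  · simp

theorem integral_sqrt_mul_betaMeasure {s t : ℝ} (hs : 0 < s) (ht : 0 < t) (f : ℝ → ℝ) :
    ∫ x, Real.sqrt x * f x ∂betaMeasure s t =
      beta (s + 1 / 2) t / beta s t * ∫ x, f x ∂betaMeasure (s + 1 / 2) t := by
  rw [integral_betaMeasure hs ht, integral_betaMeasure (by positivity) ht, ← integral_const_mul]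
  congr 1 with x
  rw [← mul_assoc, sqrt_mul_betaPDFReal hs ht, mul_assoc]

/-- Tilting by `√x` raises the first parameter by `1/2`. The tilted law gives `[0, c)` mass at most
`√c` divided by the normalizer, and the normalizer is at least the mean of the untilted law, because
`x ≤ √x` on `[0, 1]`. -/
theorem betaMeasure_real_Iio_le {s t c : ℝ} (hs : 1 ≤ s) (ht : 0 < t) :
    (betaMeasure s t).real (Set.Iio c) ≤ 2 * (s + t) / s * Real.sqrt c := by
  obtain ⟨s, rfl⟩ : ∃ s', s = s' + 1 / 2 := ⟨s - 1 / 2, by ring⟩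
  have hs0 : 0 < s := by linarith
  have hs1 : 0 < s + 1 / 2 := by linarith
  have : IsProbabilityMeasure (betaMeasure s t) := isProbabilityMeasureBeta hs0 ht
  have : IsProbabilityMeasure (betaMeasure (s + 1 / 2) t) := isProbabilityMeasureBeta hs1 ht
  have hr0 : 0 < beta (s + 1 / 2) t / beta s t := div_pos (beta_pos hs1 ht) (beta_pos hs0 ht)
  have hi : ∀ {f : ℝ → ℝ}, Continuous f → Integrable f (betaMeasure (s + 1 / 2) t) :=
    fun hf => integrable_of_continuous_betaMeasure hs1 ht hf
  have h1 := integral_sqrt_mul_betaMeasure hs0 ht (fun x => Real.sqrt x)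
  have h2 : ∫ x, Real.sqrt x * Real.sqrt x ∂betaMeasure s t = s / (s + t) := by
    rw [← integral_id_betaMeasure hs0 ht]
    refine integral_congr_ae ?_
    filter_upwards [ae_mem_Ioo_betaMeasure s t] with x hx
    exact Real.mul_self_sqrt hx.1.le
  have h3 : ∫ x, Real.sqrt x ∂betaMeasure (s + 1 / 2) t ≤ 1 := by
    calc _ ≤ ∫ x, (1 : ℝ) ∂betaMeasure (s + 1 / 2) t := by
          refine integral_mono_ae (hi (by fun_prop)) (integrable_const 1) ?_
          filter_upwards [ae_mem_Ioo_betaMeasure (s + 1 / 2) t] with x hx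
          exact Real.sqrt_le_one.2 hx.2.le
      _ = 1 := by rw [integral_const, probReal_univ, one_smul]
  have h4 := integral_sqrt_mul_betaMeasure hs0 ht ((Set.Iio c).indicator fun _ => 1)
  rw [integral_indicator_const _ measurableSet_Iio] at h4
  have h5 : ∫ x, Real.sqrt x * (Set.Iio c).indicator (fun _ => 1) x ∂betaMeasure s t
      ≤ Real.sqrt c := by
    calc _ ≤ ∫ x, Real.sqrt c ∂betaMeasure s t := by
          refine integral_mono_of_nonneg (Filter.Eventually.of_forall fun x => ?_)
            (by simp) (Filter.Eventually.of_forall fun x => ?_)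
          · exact mul_nonneg (Real.sqrt_nonneg _) (Set.indicator_nonneg (by simp) _)
          · by_cases h : x < c
            · simp only [Set.mem_Iio, h, Set.indicator_of_mem, mul_one]
              exact Real.sqrt_le_sqrt h.le
            · simp [h]
      _ = _ := by simp
  generalize beta (s + 1 / 2) t / beta s t = ρ at *
  have h6 : s / (s + t) ≤ ρ := by
    rw [← h2, h1]
    nlinarith
  have h7 : s / (s + t) * (betaMeasure (s + 1 / 2) t).real (Set.Iio c) ≤ Real.sqrt c := by
    simp only [smul_eq_mul, mul_one] at h4
    refine le_trans ?_ (h4 ▸ h5)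
    gcongr
  have h8 : (betaMeasure (s + 1 / 2) t).real (Set.Iio c) ≤ (s + t) / s * Real.sqrt c := by
    rw [div_mul_eq_mul_div, div_le_iff₀ (by positivity)] at h7
    rw [div_mul_eq_mul_div, le_div_iff₀ hs0]
    linarith
  refine h8.trans ?_
  gcongr ?_ * _
  rw [div_le_div_iff₀ hs0 hs1]
  nlinarith

/-! ### Increasing functions of one variable. -/

/-- For an increasing `F`, the `L¹` distance of `F` to a constant is controlled by the covariance
of `F` with the identity. -/
theorem integral_abs_sub_le_of_monotone {ρ : Measure ℝ} [IsProbabilityMeasure ρ] {m d M : ℝ}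
    (hid : Integrable (fun b => b) ρ) (hm : ∫ b, b ∂ρ = m) (hd : 0 < d)
    (hdm : 4 * d ≤ ∫ b, |b - m| ∂ρ) {F : ℝ → ℝ} (hF : Monotone F) (hM : ∀ b, |F b| ≤ M) :
    ∫ b, |F b - F m| ∂ρ ≤ 3 / d * ∫ b, F b * (b - m) ∂ρ := by
  have hFm : AEStronglyMeasurable F ρ := hF.measurable.aestronglyMeasurable
  have hFi : Integrable F ρ := Integrable.of_bound hFm M (Filter.Eventually.of_forall hM)
  have hbm : Integrable (fun b => b - m) ρ := hid.sub (integrable_const m)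
  have hFb : Integrable (fun b => F b * (b - m)) ρ :=
    hbm.bdd_mul hFm (Filter.Eventually.of_forall hM)
  have hG : Integrable (fun b => (F b - F m) * (b - m)) ρ := by
    simp only [sub_mul]
    exact hFb.sub (hbm.const_mul (F m))
  have hb0 : ∫ b, (b - m) ∂ρ = 0 := by
    rw [integral_sub hid (integrable_const m), hm]
    simp
  set C := ∫ b, F b * (b - m) ∂ρ with hC
  have hGC : ∫ b, (F b - F m) * (b - m) ∂ρ = C := by
    simp only [sub_mul]
    rw [integral_sub hFb (hbm.const_mul (F m)), integral_const_mul, hb0, mul_zero,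
      sub_zero]
  have habs : Integrable (fun b => |b - m|) ρ := hbm.abs
  have h1 : (F (m + d) - F m) * d ≤ C := by
    have h0 : 0 ≤ F (m + d) - F m := sub_nonneg.2 (hF (by linarith))
    -- The bracket is `(b - m)⁺ - d`. Since `b - m` is centred, its positive part has mean `E|b - m|
    -- / 2 ≥ 2d`, so the bracket has mean at least `d`.
    have : ∫ b, (F (m + d) - F m) * ((|b - m| + (b - m)) / 2 - d) ∂ρ ≤ C := by
      rw [← hGC]
      refine integral_mono ((((hbm.abs.add hbm).div_const 2).sub (integrable_const d)).const_mul _)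
        hG fun b => ?_
      rcases le_total b m with h | h
      · have : F b ≤ F m := hF h
        have h3 : 0 ≤ (F b - F m) * (b - m) := mul_nonneg_of_nonpos_of_nonpos (by linarith) (by linarith)
        simp only [abs_of_nonpos (sub_nonpos.2 h)]
        nlinarith
      · simp only [abs_of_nonneg (sub_nonneg.2 h)]
        have : F m ≤ F b := hF h
        rcases le_total b (m + d) with h' | h'
        · nlinarith [mul_nonneg (sub_nonneg.2 this) (sub_nonneg.2 h)]
        · have : F (m + d) ≤ F b := hF h'
          nlinarith
    have hi : Integrable (fun b => (|b - m| + (b - m)) / 2) ρ := (habs.add hbm).div_const 2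
    rw [integral_const_mul, integral_sub hi (integrable_const d),
      integral_div, integral_add habs hbm, hb0] at this
    simp only [integral_const, probReal_univ, smul_eq_mul, one_mul, add_zero] at this
    refine le_trans ?_ this
    gcongr
    linarith
  have h2 : (F m - F (m - d)) * d ≤ C := by
    have h0 : 0 ≤ F m - F (m - d) := sub_nonneg.2 (hF (by linarith))
    have : ∫ b, (F m - F (m - d)) * ((|b - m| - (b - m)) / 2 - d) ∂ρ ≤ C := by
      rw [← hGC]
      refine integral_mono ((((hbm.abs.sub hbm).div_const 2).sub (integrable_const d)).const_mul _)
        hG fun b => ?_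
      rcases le_total m b with h | h
      · have : F m ≤ F b := hF h
        have h3 : 0 ≤ (F b - F m) * (b - m) := mul_nonneg (by linarith) (by linarith)
        simp only [abs_of_nonneg (sub_nonneg.2 h)]
        nlinarith
      · simp only [abs_of_nonpos (sub_nonpos.2 h)]
        have : F b ≤ F m := hF h
        rcases le_total (m - d) b with h' | h'
        · nlinarith [mul_nonneg (sub_nonneg.2 this) (sub_nonneg.2 h)]
        · have : F b ≤ F (m - d) := hF h'
          nlinarith
    have hi : Integrable (fun b => (|b - m| - (b - m)) / 2) ρ := (habs.sub hbm).div_const 2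
    rw [integral_const_mul, integral_sub hi (integrable_const d),
      integral_div, integral_sub habs hbm, hb0] at this
    simp only [integral_const, probReal_univ, smul_eq_mul, one_mul, sub_zero] at this
    refine le_trans ?_ this
    gcongr
    linarith
  -- Beyond distance `d` from `m` the covariance integrand dominates; within it, the oscillation of
  -- `F` on `[m - d, m + d]` does. The three contributions are each at most `C / d`.
  have h3 : ∫ b, |F b - F m| ∂ρ ≤
      ∫ b, (1 / d * ((F b - F m) * (b - m)) + ((F (m + d) - F m) + (F m - F (m - d)))) ∂ρ := by
    refine integral_mono (hFi.sub (integrable_const _)).abs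
      ((hG.const_mul _).add (integrable_const _)) fun b => ?_
    have e1 : F m ≤ F (m + d) := hF (by linarith)
    have e2 : F (m - d) ≤ F m := hF (by linarith)
    show |F b - F m| ≤ 1 / d * ((F b - F m) * (b - m)) + ((F (m + d) - F m) + (F m - F (m - d)))
    have key : ∀ g z : ℝ, 0 ≤ g → d ≤ z → g ≤ 1 / d * (g * z) := fun g z hg hz => by
      rw [one_div_mul_eq_div, le_div_iff₀ hd]
      gcongr
    rcases le_total m b with h | h
    · have : F m ≤ F b := hF h
      rw [abs_of_nonneg (by linarith)]
      rcases le_total b (m + d) with h' | h'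
      · have : F b ≤ F (m + d) := hF h'
        have : 0 ≤ 1 / d * ((F b - F m) * (b - m)) :=
          mul_nonneg (by positivity) (mul_nonneg (by linarith) (by linarith))
        linarith
      · have := key (F b - F m) (b - m) (by linarith) (by linarith)
        linarith
    · have : F b ≤ F m := hF h
      rw [abs_of_nonpos (by linarith), show (F b - F m) * (b - m) = -(F b - F m) * (m - b) by ring]
      rcases le_total (m - d) b with h' | h'
      · have : F (m - d) ≤ F b := hF h'
        have : 0 ≤ 1 / d * (-(F b - F m) * (m - b)) :=
          mul_nonneg (by positivity) (mul_nonneg (by linarith) (by linarith))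
        linarith
      · have := key (-(F b - F m)) (m - b) (by linarith) (by linarith)
        linarith
  rw [integral_add (hG.const_mul _) (integrable_const _), integral_const_mul, hGC] at h3
  simp only [integral_const, probReal_univ, smul_eq_mul, one_mul] at h3
  refine h3.trans ?_
  rw [div_mul_eq_mul_div, div_mul_eq_mul_div, ← sub_nonneg]
  rw [← le_div_iff₀ hd] at h1 h2
  have : 3 * C / d = 1 * C / d + C / d + C / d := by ring
  linarith

/-- An increasing function is negatively correlated with the event `b < c`. -/
theorem integral_mul_indicator_Iio_le {ρ : Measure ℝ} [IsProbabilityMeasure ρ] {M : ℝ} (c : ℝ)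
    {F : ℝ → ℝ} (hF : Monotone F) (hM : ∀ b, |F b| ≤ M) :
    ∫ b, F b * (Set.Iio c).indicator (fun _ => 1) b ∂ρ ≤ ρ.real (Set.Iio c) * ∫ b, F b ∂ρ := by
  have hFi : Integrable F ρ := Integrable.of_bound hF.measurable.aestronglyMeasurable M
    (Filter.Eventually.of_forall hM)
  set p := ρ.real (Set.Iio c) with hp
  have hp0 : 0 ≤ p := measureReal_nonneg
  have hp1 : p ≤ 1 := measureReal_le_one
  set I : ℝ → ℝ := (Set.Iio c).indicator (fun _ => 1) with hI
  have hIi : Integrable I ρ := (integrable_const 1).indicator measurableSet_Iio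
  have hIp : ∫ b, I b ∂ρ = p := by
    rw [hI, integral_indicator_const _ measurableSet_Iio]
    simp [hp]
  have hFI : Integrable (fun b => F b * I b) ρ :=
    hIi.bdd_mul hF.measurable.aestronglyMeasurable (Filter.Eventually.of_forall hM)
  -- This is `(F b - F c) (I b - p) ≤ 0`: the two factors have opposite signs on either side of `c`.
  have hle : ∀ b, F b * I b ≤ p * F b + F c * I b - F c * p := by
    intro b
    by_cases h : b < c
    · have hb : I b = 1 := by simp [hI, h]
      rw [hb]
      nlinarith [hF h.le]
    · have hb : I b = 0 := by simp [hI, h]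
      rw [hb]
      nlinarith [hF (not_lt.1 h)]
  have hi : Integrable (fun b => p * F b + F c * I b) ρ :=
    (hFi.const_mul p).add (hIi.const_mul (F c))
  refine (integral_mono hFI (hi.sub (integrable_const (F c * p))) hle).trans ?_
  change ∫ b, (p * F b + F c * I b - F c * p) ∂ρ ≤ _
  rw [integral_sub hi (integrable_const _), integral_add (hFi.const_mul p) (hIi.const_mul (F c)),
    integral_const_mul, integral_const_mul, hIp]
  simp

/-! ### Configurations on an interval, their weights and scaling. -/

noncomputable section

/-- The `k`-th point of a configuration of `m` points on `[0, L]`, endpoints included. -/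
def pos (L : ℝ) {m : ℕ} (x : Fin m → ℝ) (k : ℕ) : ℝ :=
  if k = 0 then 0 else if h : k - 1 < m then x ⟨k - 1, h⟩ else L

@[simp] theorem pos_zero (L : ℝ) {m : ℕ} (x : Fin m → ℝ) : pos L x 0 = 0 := by simp [pos]

theorem pos_of_lt (L : ℝ) {m : ℕ} (x : Fin m → ℝ) {k : ℕ} (h : m < k) : pos L x k = L := by
  have h1 : k ≠ 0 := by omega
  have h2 : ¬ k - 1 < m := by omega
  simp [pos, h1, h2]

@[fun_prop]
theorem measurable_pos_uncurry (m k : ℕ) :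
    Measurable fun z : ℝ × (Fin m → ℝ) => pos z.1 z.2 k := by
  unfold pos
  split_ifs <;> fun_prop

@[fun_prop]
theorem measurable_pos (L : ℝ) (m k : ℕ) : Measurable fun x : Fin m → ℝ => pos L x k :=
  (measurable_pos_uncurry m k).comp (measurable_const.prodMk measurable_id)

theorem pos_smul (c L : ℝ) {m : ℕ} (x : Fin m → ℝ) (k : ℕ) :
    pos (c * L) (c • x) k = c * pos L x k := by
  unfold pos
  split_ifs <;> simp

/-- The unnormalized density of a single gap. -/
def gapWeight (α t : ℝ) : ENNReal := if 0 ≤ t then ENNReal.ofReal (t ^ (α - 1)) else 0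

@[fun_prop]
theorem measurable_gapWeight (α : ℝ) : Measurable (gapWeight α) :=
  Measurable.ite measurableSet_Ici (by fun_prop) measurable_const

theorem gapWeight_mul (α : ℝ) {c : ℝ} (hc : 0 < c) (t : ℝ) :
    gapWeight α (c * t) = ENNReal.ofReal (c ^ (α - 1)) * gapWeight α t := by
  unfold gapWeight
  by_cases h : 0 ≤ t
  · rw [if_pos h, if_pos (by positivity), Real.mul_rpow hc.le h, ENNReal.ofReal_mul (by positivity)]
  · rw [if_neg h, if_neg (by rw [mul_nonneg_iff_of_pos_left hc]; exact h), mul_zero]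

/-- The unnormalized density of a configuration of `m` points on `[0, L]`. -/
def weight (α L : ℝ) {m : ℕ} (x : Fin m → ℝ) : ENNReal :=
  ∏ i ∈ Finset.range (m + 1), gapWeight α (pos L x (i + 1) - pos L x i)

theorem measurable_weight_uncurry (α : ℝ) (m : ℕ) :
    Measurable fun z : ℝ × (Fin m → ℝ) => weight α z.1 z.2 := by
  unfold weight
  fun_prop

@[fun_prop]
theorem measurable_weight (α L : ℝ) (m : ℕ) : Measurable (weight α L (m := m)) :=
  (measurable_weight_uncurry α m).comp (measurable_const.prodMk measurable_id)

theorem pos_le_pos_of_weight_ne_zero {α L : ℝ} {m : ℕ} {x : Fin m → ℝ} (h : weight α L x ≠ 0)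
    {i : ℕ} (hi : i < m + 1) : pos L x i ≤ pos L x (i + 1) := by
  by_contra hlt
  refine h (Finset.prod_eq_zero (Finset.mem_range.2 hi) ?_)
  rw [gapWeight, if_neg (by linarith)]

theorem pos_nonneg_of_weight_ne_zero {α L : ℝ} {m : ℕ} {x : Fin m → ℝ} (h : weight α L x ≠ 0)
    {i : ℕ} (hi : i ≤ m + 1) : 0 ≤ pos L x i := by
  induction i with
  | zero => simp
  | succ i ih =>
    exact (ih (by omega)).trans (pos_le_pos_of_weight_ne_zero h (by omega))

theorem pos_le_of_weight_ne_zero {α L : ℝ} {m : ℕ} {x : Fin m → ℝ} (h : weight α L x ≠ 0)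
    {i : ℕ} (hi : i ≤ m + 1) : pos L x i ≤ L := by
  induction hi using Nat.decreasingInduction with
  | self => rw [pos_of_lt L x (by omega)]
  | of_succ i hi ih => exact (pos_le_pos_of_weight_ne_zero h hi).trans ih

theorem weight_of_neg (α : ℝ) {L : ℝ} (hL : L < 0) {m : ℕ} (x : Fin m → ℝ) : weight α L x = 0 := by
  by_contra h
  have := pos_nonneg_of_weight_ne_zero h le_rfl
  rw [pos_of_lt L x (by omega)] at this
  linarith

theorem weight_smul (α : ℝ) {c : ℝ} (hc : 0 < c) (L : ℝ) {m : ℕ} (x : Fin m → ℝ) :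
    weight α (c * L) (c • x) = ENNReal.ofReal ((c ^ (α - 1)) ^ (m + 1)) * weight α L x := by
  unfold weight
  simp only [pos_smul, ← mul_sub, gapWeight_mul α hc, Finset.prod_mul_distrib]
  rw [Finset.prod_const, Finset.card_range, ENNReal.ofReal_pow (by positivity)]

/-- The exponent collects `(m + 1)(α - 1)` from the gaps and `m` from the Jacobian. -/
theorem lintegral_weight_smul (α : ℝ) {c : ℝ} (hc : 0 < c) (m : ℕ) {G : (Fin m → ℝ) → ENNReal}
    (hG : Measurable G) :
    ∫⁻ x, weight α c x * G x =
      ENNReal.ofReal (c ^ ((m + 1) * α - 1)) * ∫⁻ x, weight α 1 x * G (c • x) := by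
  have h := Measure.map_addHaar_smul (volume : Measure (Fin m → ℝ)) hc.ne'
  have h1 : ∫⁻ x : Fin m → ℝ, weight α c (c • x) * G (c • x) =
      ENNReal.ofReal ((c ^ m)⁻¹) * ∫⁻ x, weight α c x * G x := by
    rw [← lintegral_map (f := fun x => weight α c x * G x) (g := fun x => c • x) (by fun_prop)
      (by fun_prop), h, lintegral_smul_measure]
    simp [abs_of_pos hc]
  have h2 : ∀ x : Fin m → ℝ, weight α c (c • x) * G (c • x) =
      ENNReal.ofReal ((c ^ (α - 1)) ^ (m + 1)) * (weight α 1 x * G (c • x)) := fun x => by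
    have := weight_smul α hc 1 x
    rw [mul_one] at this
    rw [this, mul_assoc]
  simp only [h2] at h1
  rw [lintegral_const_mul _ (by fun_prop)] at h1
  have h3 : ∫⁻ x, weight α c x * G x =
      ENNReal.ofReal (c ^ m) * (ENNReal.ofReal ((c ^ m)⁻¹) * ∫⁻ x, weight α c x * G x) := by
    rw [← mul_assoc, ← ENNReal.ofReal_mul (by positivity), mul_inv_cancel₀ (by positivity)]
    simp
  rw [h3, ← h1, ← mul_assoc, ← ENNReal.ofReal_mul (by positivity), ← Real.rpow_natCast,
    ← Real.rpow_natCast, ← Real.rpow_mul hc.le, ← Real.rpow_add hc]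
  congr 3
  push_cast
  ring

/-! ### Cutting a configuration at one of its points. -/

/-- Concatenation of a configuration `v`, a point `y` and a configuration `w`. -/
def join {p q : ℕ} (v : Fin p → ℝ) (y : ℝ) (w : Fin q → ℝ) : Fin (p + 1 + q) → ℝ :=
  Fin.append (Fin.snoc (α := fun _ => ℝ) v y) w

theorem pos_join_left (L : ℝ) {p q : ℕ} (v : Fin p → ℝ) (y : ℝ) (w : Fin q → ℝ) {k : ℕ}
    (hk : k ≤ p + 1) : pos L (join v y w) k = pos y v k := by
  rcases k with _ | k
  · simp
  have h1 : k < p + 1 + q := by omega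
  have e : (⟨k, h1⟩ : Fin (p + 1 + q)) = Fin.castAdd q ⟨k, by omega⟩ := rfl
  simp only [pos, Nat.add_one_ne_zero, if_false, Nat.add_sub_cancel, h1, dif_pos, join, e,
    Fin.append_left]
  by_cases h : k < p
  · simp [Fin.snoc, h]
  · simp [Fin.snoc, h]

theorem pos_join_right (L : ℝ) {p q : ℕ} (v : Fin p → ℝ) (y : ℝ) (w : Fin q → ℝ) (k : ℕ) :
    pos L (join v y fun j => y + w j) (p + 1 + k) = y + pos (L - y) w k := by
  rcases k with _ | k
  · rw [add_zero, pos_join_left _ _ _ _ le_rfl, pos_of_lt _ _ (by omega)]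
    simp
  have e0 : p + 1 + (k + 1) - 1 = p + 1 + k := by omega
  by_cases h : k < q
  · have h1 : p + 1 + k < p + 1 + q := by omega
    have e : (⟨p + 1 + k, h1⟩ : Fin (p + 1 + q)) = Fin.natAdd (p + 1) ⟨k, h⟩ := rfl
    rw [pos, if_neg (by omega), dif_pos (by omega)]
    simp only [e0, join, e, Fin.append_right]
    simp [pos, h]
  · rw [pos_of_lt _ _ (by omega), pos_of_lt _ _ (by omega)]
    ring

theorem weight_join (α L : ℝ) {p q : ℕ} (v : Fin p → ℝ) (y : ℝ) (w : Fin q → ℝ) :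
    weight α L (join v y fun j => y + w j) = weight α y v * weight α (L - y) w := by
  unfold weight
  rw [show p + 1 + q + 1 = (p + 1) + (q + 1) by ring, Finset.prod_range_add]
  congr 1
  · refine Finset.prod_congr rfl fun i hi => ?_
    have := Finset.mem_range.1 hi
    rw [pos_join_left _ _ _ _ (by omega), pos_join_left _ _ _ _ (by omega)]
  · refine Finset.prod_congr rfl fun i _ => ?_
    rw [add_assoc (p + 1) i 1, pos_join_right, pos_join_right]
    congr 1
    ring

theorem measurable_join (p q : ℕ) :
    Measurable fun z : ℝ × (Fin p → ℝ) × (Fin q → ℝ) => join z.2.1 z.1 z.2.2 := by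
  refine measurable_pi_iff.2 fun i => ?_
  refine Fin.addCases (fun i => ?_) (fun i => ?_) i
  · simp only [join, Fin.append_left]
    refine Fin.lastCases ?_ (fun i => ?_) i
    · simp only [Fin.snoc_last]
      fun_prop
    · simp only [Fin.snoc_castSucc]
      fun_prop
  · simp only [join, Fin.append_right]
    fun_prop

@[fun_prop]
theorem Measurable.join {X : Type*} [MeasurableSpace X] {p q : ℕ} {f : X → Fin p → ℝ} {g : X → ℝ}
    {h : X → Fin q → ℝ} (hf : Measurable f) (hg : Measurable g) (hh : Measurable h) :
    Measurable fun x => SimplexWalk.join (f x) (g x) (h x) :=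
  (measurable_join p q).comp (hg.prodMk (hf.prodMk hh))

theorem map_join_volume (p q : ℕ) :
    ((volume : Measure ℝ).prod
      ((volume : Measure (Fin p → ℝ)).prod (volume : Measure (Fin q → ℝ)))).map
      (fun z => join z.2.1 z.1 z.2.2) = volume := by
  symm
  refine Measure.pi_eq fun s hs => ?_
  rw [Measure.map_apply (measurable_join p q) (MeasurableSet.univ_pi hs)]
  have : (fun z : ℝ × (Fin p → ℝ) × (Fin q → ℝ) => join z.2.1 z.1 z.2.2) ⁻¹' Set.univ.pi s =
      s (Fin.castAdd q (Fin.last p)) ×ˢ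
        ((Set.univ.pi fun i => s (Fin.castAdd q i.castSucc)) ×ˢ
          (Set.univ.pi fun i => s (Fin.natAdd (p + 1) i))) := by
    ext z
    simp only [Set.mem_preimage, Set.mem_pi, Set.mem_univ, true_imp_iff, Set.mem_prod, join]
    constructor
    · intro h
      refine ⟨?_, fun i => ?_, fun i => ?_⟩
      · simpa [Fin.append_left] using h (Fin.castAdd q (Fin.last p))
      · simpa only [Fin.append_left, Fin.snoc_castSucc] using h (Fin.castAdd q i.castSucc)
      · simpa only [Fin.append_right] using h (Fin.natAdd (p + 1) i)
    · rintro ⟨h1, h2, h3⟩ i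
      refine Fin.addCases (fun i => ?_) (fun i => ?_) i
      · rw [Fin.append_left]
        refine Fin.lastCases ?_ (fun i => ?_) i
        · simpa only [Fin.snoc_last] using h1
        · simpa only [Fin.snoc_castSucc] using h2 i
      · simpa only [Fin.append_right] using h3 i
  rw [this, Measure.prod_prod, Measure.prod_prod, volume_pi_pi, volume_pi_pi, Fin.prod_univ_add,
    Fin.prod_univ_castSucc]
  ring

/-- Lebesgue measure factors over the three pieces, and translating the upper piece by `y` makes its
weight that of an interval of length `L - y`. -/
theorem lintegral_weight_split (α L : ℝ) (p q : ℕ) {G : (Fin (p + 1 + q) → ℝ) → ENNReal}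
    (hG : Measurable G) :
    ∫⁻ x, weight α L x * G x =
      ∫⁻ y, ∫⁻ v : Fin p → ℝ, ∫⁻ w : Fin q → ℝ,
        weight α y v * weight α (L - y) w * G (join v y fun j => y + w j) := by
  obtain ⟨H, hH⟩ : ∃ H : (Fin (p + 1 + q) → ℝ) → ENNReal, H = fun x => weight α L x * G x :=
    ⟨_, rfl⟩
  have hm : Measurable H := hH ▸ (measurable_weight α L _).mul hG
  have h1 : ∫⁻ x, weight α L x * G x = ∫⁻ x, H x := by rw [hH]
  have hm1 : Measurable fun z : ℝ × (Fin p → ℝ) × (Fin q → ℝ) => H (join z.2.1 z.1 z.2.2) := by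
    fun_prop
  rw [h1, ← map_join_volume p q, lintegral_map hm (measurable_join p q),
    lintegral_prod _ hm1.aemeasurable]
  refine lintegral_congr fun y => ?_
  have hm2 : Measurable fun z : (Fin p → ℝ) × (Fin q → ℝ) => H (join z.1 y z.2) := by
    fun_prop
  rw [lintegral_prod _ hm2.aemeasurable]
  refine lintegral_congr fun v => ?_
  have h2 := lintegral_add_left_eq_self (μ := (volume : Measure (Fin q → ℝ)))
    (fun w => H (join v y w)) (fun _ => y)
  refine h2.symm.trans (lintegral_congr fun w => ?_)
  rw [← weight_join, hH]
  rfl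

/-! ### The Dirichlet law and its decomposition at a beta-distributed point. -/

/-- The normalizing constant of the law of `m` points on `[0, 1]`. -/
def partition (α : ℝ) (m : ℕ) : ℝ := Real.Gamma α ^ (m + 1) / Real.Gamma ((m + 1) * α)

theorem partition_pos {α : ℝ} (hα : 0 < α) (m : ℕ) : 0 < partition α m := by
  have h1 := Real.Gamma_pos_of_pos hα
  have h2 : 0 < Real.Gamma ((m + 1) * α) := Real.Gamma_pos_of_pos (by positivity)
  unfold partition
  positivity

theorem partition_split {α : ℝ} (hα : 0 < α) (p q : ℕ) :
    partition α (p + 1 + q) =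
      beta ((p + 1) * α) ((q + 1) * α) * (partition α p * partition α q) := by
  have h1 : Real.Gamma ((p + 1) * α) ≠ 0 := (Real.Gamma_pos_of_pos (by positivity)).ne'
  have h2 : Real.Gamma ((q + 1) * α) ≠ 0 := (Real.Gamma_pos_of_pos (by positivity)).ne'
  have h3 : Real.Gamma ((p + 1) * α + (q + 1) * α) ≠ 0 :=
    (Real.Gamma_pos_of_pos (by positivity)).ne'
  unfold partition beta
  have e : ((p + 1 + q : ℕ) + 1 : ℝ) * α = (p + 1) * α + (q + 1) * α := by push_cast; ring
  rw [e]
  field_simp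
  ring

/-- The law of `m` points on `[0, 1]` whose gaps have the symmetric Dirichlet distribution. -/
def simplexLaw (α : ℝ) (m : ℕ) : Measure (Fin m → ℝ) :=
  ENNReal.ofReal (partition α m)⁻¹ • volume.withDensity (weight α 1)

theorem lintegral_simplexLaw (α : ℝ) (m : ℕ) {G : (Fin m → ℝ) → ENNReal} (hG : Measurable G) :
    ∫⁻ x, G x ∂simplexLaw α m =
      ENNReal.ofReal (partition α m)⁻¹ * ∫⁻ x, weight α 1 x * G x := by
  rw [simplexLaw, lintegral_smul_measure, lintegral_withDensity_eq_lintegral_mul _ (by fun_prop) hG]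
  rfl

/-- The configuration on `[0, 1]` with a point at `b`, the rescaled configuration `v` below it and
the rescaled configuration `w` above it. -/
def glue {p q : ℕ} (b : ℝ) (v : Fin p → ℝ) (w : Fin q → ℝ) : Fin (p + 1 + q) → ℝ :=
  join (b • v) b fun j => b + ((1 - b) • w) j

@[fun_prop]
theorem Measurable.glue {X : Type*} [MeasurableSpace X] {p q : ℕ} {f : X → Fin p → ℝ} {g : X → ℝ}
    {h : X → Fin q → ℝ} (hf : Measurable f) (hg : Measurable g) (hh : Measurable h) :
    Measurable fun x => SimplexWalk.glue (g x) (f x) (h x) := by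
  unfold SimplexWalk.glue
  simp only [Pi.smul_apply, smul_eq_mul]
  fun_prop

theorem pos_glue_left {p q : ℕ} (b : ℝ) (v : Fin p → ℝ) (w : Fin q → ℝ) {k : ℕ}
    (hk : k ≤ p + 1) : pos 1 (glue b v w) k = b * pos 1 v k := by
  rw [glue, pos_join_left _ _ _ _ hk, ← pos_smul, mul_one]

instance (α : ℝ) (m : ℕ) : SFinite (simplexLaw α m) := by
  unfold simplexLaw
  infer_instance

/-- Rescaling the two pieces to unit length produces the factors `y ^ ((p+1)α - 1)` and `(1-y) ^
((q+1)α - 1)`, and `partition_split` supplies exactly the normalization of the beta density. -/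
theorem lintegral_simplexLaw_split {α : ℝ} (hα : 0 < α) (p q : ℕ)
    {G : (Fin (p + 1 + q) → ℝ) → ENNReal} (hG : Measurable G) :
    ∫⁻ x, G x ∂simplexLaw α (p + 1 + q) =
      ∫⁻ b, ∫⁻ v, ∫⁻ w, G (glue b v w) ∂simplexLaw α q ∂simplexLaw α p
        ∂betaMeasure ((p + 1) * α) ((q + 1) * α) := by
  have hinner : Measurable fun b : ℝ =>
      ∫⁻ v, ∫⁻ w, G (glue b v w) ∂simplexLaw α q ∂simplexLaw α p := by
    have h1 : Measurable fun z : (ℝ × (Fin p → ℝ)) × (Fin q → ℝ) => G (glue z.1.1 z.1.2 z.2) :=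
      hG.comp (by fun_prop)
    have h2 : Measurable fun z : ℝ × (Fin p → ℝ) => ∫⁻ w, G (glue z.1 z.2 w) ∂simplexLaw α q :=
      h1.lintegral_prod_right'
    exact h2.lintegral_prod_right'
  rw [lintegral_simplexLaw α _ hG, lintegral_weight_split α 1 p q hG, betaMeasure,
    lintegral_withDensity_eq_lintegral_mul _ (by unfold betaPDF; fun_prop) hinner,
    ← lintegral_const_mul' _ _ ENNReal.ofReal_ne_top]
  refine lintegral_congr_ae ?_
  have h0 : ∀ᵐ y : ℝ, y ≠ 0 := by simp [ae_iff]
  have h1 : ∀ᵐ y : ℝ, y ≠ 1 := by simp [ae_iff]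
  filter_upwards [h0, h1] with y hy0 hy1
  simp only [Pi.mul_apply]
  by_cases hy : 0 < y ∧ y < 1
  swap
  · have : betaPDF ((p + 1) * α) ((q + 1) * α) y = 0 := by simp [betaPDF, betaPDFReal, hy]
    rw [this, zero_mul]
    have : y < 0 ∨ 1 - y < 0 := by
      rcases lt_or_gt_of_ne hy0 with h | h
      · exact Or.inl h
      · rcases lt_or_gt_of_ne hy1 with h' | h'
        · exact absurd ⟨h, h'⟩ hy
        · right
          linarith
    rcases this with h | h <;> simp [weight_of_neg α h]
  have hy' : 0 < 1 - y := by linarith [hy.2]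
  have hm3 : Measurable fun v : Fin p → ℝ =>
      ∫⁻ w : Fin q → ℝ, weight α 1 w * G (glue y v w) := by
    refine Measurable.lintegral_prod_right' (f := fun z : (Fin p → ℝ) × (Fin q → ℝ) =>
      weight α 1 z.2 * G (glue y z.1 z.2)) ?_
    fun_prop
  have hm4 : Measurable fun v : Fin p → ℝ =>
      weight α 1 v * ∫⁻ w : Fin q → ℝ, weight α 1 w * G (glue y v w) :=
    (measurable_weight α 1 p).mul hm3
  set J := ∫⁻ v : Fin p → ℝ, weight α 1 v * ∫⁻ w : Fin q → ℝ, weight α 1 w * G (glue y v w) with hJ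
  have e1 : ∫⁻ v : Fin p → ℝ, ∫⁻ w : Fin q → ℝ,
      weight α y v * weight α (1 - y) w * G (join v y fun j => y + w j) =
        ENNReal.ofReal (y ^ ((p + 1) * α - 1)) *
          (ENNReal.ofReal ((1 - y) ^ ((q + 1) * α - 1)) * J) := by
    have h : ∀ v : Fin p → ℝ, ∫⁻ w : Fin q → ℝ,
        weight α y v * weight α (1 - y) w * G (join v y fun j => y + w j) =
          weight α y v * (ENNReal.ofReal ((1 - y) ^ ((q + 1) * α - 1)) *
            ∫⁻ w : Fin q → ℝ, weight α 1 w * G (join v y fun j => y + ((1 - y) • w) j)) := by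
      intro v
      simp only [mul_assoc]
      rw [lintegral_const_mul _ (by fun_prop), lintegral_weight_smul α hy' q (by fun_prop)]
    have hm2 : Measurable fun v : Fin p → ℝ => ∫⁻ w : Fin q → ℝ,
        weight α 1 w * G (join v y fun j => y + ((1 - y) • w) j) := by
      refine Measurable.lintegral_prod_right' (f := fun z : (Fin p → ℝ) × (Fin q → ℝ) =>
        weight α 1 z.2 * G (join z.1 y fun j => y + ((1 - y) • z.2) j)) ?_
      simp only [Pi.smul_apply, smul_eq_mul]
      fun_prop
    simp only [h]
    rw [lintegral_weight_smul α hy.1 p (hm2.const_mul _), hJ,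
      ← lintegral_const_mul _ hm4]
    congr 1
    refine lintegral_congr fun x => ?_
    rw [mul_left_comm]
    rfl
  have e2 : ∫⁻ v, ∫⁻ w, G (glue y v w) ∂simplexLaw α q ∂simplexLaw α p =
      ENNReal.ofReal (partition α p)⁻¹ * (ENNReal.ofReal (partition α q)⁻¹ * J) := by
    have h : ∀ v : Fin p → ℝ, ∫⁻ w, G (glue y v w) ∂simplexLaw α q =
        ENNReal.ofReal (partition α q)⁻¹ * ∫⁻ w : Fin q → ℝ, weight α 1 w * G (glue y v w) :=
      fun v => lintegral_simplexLaw α q (by fun_prop)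
    simp only [h]
    rw [lintegral_simplexLaw α p (hm3.const_mul _), hJ,
      ← lintegral_const_mul _ hm4]
    congr 1
    refine lintegral_congr fun x => ?_
    rw [mul_left_comm]
  have hp := partition_pos hα p
  have hq := partition_pos hα q
  have hb : 0 < beta ((p + 1) * α) ((q + 1) * α) := beta_pos (by positivity) (by positivity)
  have hy1' := Real.rpow_nonneg hy.1.le ((p + 1) * α - 1)
  have hy2' := Real.rpow_nonneg hy'.le ((q + 1) * α - 1)
  rw [e1, e2, betaPDF_of_pos_lt_one hy.1 hy.2, partition_split hα]
  simp only [← mul_assoc]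
  rw [← ENNReal.ofReal_mul (by positivity), ← ENNReal.ofReal_mul (by positivity),
    ← ENNReal.ofReal_mul (by positivity), ← ENNReal.ofReal_mul (by positivity)]
  congr 2
  field_simp

theorem simplexLaw_zero {α : ℝ} (hα : 0 < α) : IsProbabilityMeasure (simplexLaw α 0) := by
  constructor
  rw [← lintegral_one, lintegral_simplexLaw α 0 measurable_const]
  have h : partition α 0 = 1 := by
    have := (Real.Gamma_pos_of_pos hα).ne'
    simp [partition, this]
  have h2 : ∀ x : Fin 0 → ℝ, weight α 1 x = 1 := fun x => by
    simp [weight, gapWeight, pos]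
  simp [h, h2, volume_pi]

/-- Cutting at the last point (`q = 0`) reduces the Dirichlet integral to beta integrals, one point
at a time. -/
theorem isProbabilityMeasure_simplexLaw {α : ℝ} (hα : 0 < α) (m : ℕ) :
    IsProbabilityMeasure (simplexLaw α m) := by
  induction m with
  | zero => exact simplexLaw_zero hα
  | succ m ih =>
    have := simplexLaw_zero hα
    have : IsProbabilityMeasure (betaMeasure ((m + 1) * α) (((0 : ℕ) + 1) * α)) :=
      isProbabilityMeasureBeta (by positivity) (by positivity)
    constructor
    rw [← lintegral_one]
    refine (lintegral_simplexLaw_split hα m 0 (measurable_const (a := 1))).trans ?_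
    simpa using this.measure_univ

theorem measurePreserving_glue {α : ℝ} (hα : 0 < α) (p q : ℕ) :
    MeasurePreserving (fun z : (ℝ × (Fin p → ℝ)) × (Fin q → ℝ) => glue z.1.1 z.1.2 z.2)
      (((betaMeasure ((p + 1) * α) ((q + 1) * α)).prod (simplexLaw α p)).prod (simplexLaw α q))
      (simplexLaw α (p + 1 + q)) := by
  have hm : Measurable fun z : (ℝ × (Fin p → ℝ)) × (Fin q → ℝ) => glue z.1.1 z.1.2 z.2 := by
    fun_prop
  have : IsProbabilityMeasure (betaMeasure ((p + 1) * α) ((q + 1) * α)) :=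
      isProbabilityMeasureBeta (by positivity) (by positivity)
  refine ⟨hm, Measure.ext_of_lintegral _ fun G hG => ?_⟩
  rw [lintegral_map hG hm, lintegral_simplexLaw_split hα p q hG, lintegral_prod _ (by fun_prop),
    lintegral_prod]
  refine (Measurable.lintegral_prod_right'
    (f := fun z : (ℝ × (Fin p → ℝ)) × (Fin q → ℝ) => G (glue z.1.1 z.1.2 z.2)) ?_).aemeasurable
  fun_prop

theorem ae_pos_mem_Icc_simplexLaw (α : ℝ) (m : ℕ) :
    ∀ᵐ x ∂simplexLaw α m, ∀ i ≤ m + 1, pos 1 x i ∈ Set.Icc (0 : ℝ) 1 := by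
  refine Measure.ae_smul_measure ?_ _
  rw [ae_withDensity_iff (measurable_weight α 1 m)]
  exact Filter.Eventually.of_forall fun x hx i hi =>
    ⟨pos_nonneg_of_weight_ne_zero hx hi, pos_le_of_weight_ne_zero hx hi⟩

theorem ae_mem_Icc_simplexLaw (α : ℝ) (m : ℕ) :
    ∀ᵐ x ∂simplexLaw α m, ∀ i, x i ∈ Set.Icc (0 : ℝ) 1 := by
  filter_upwards [ae_pos_mem_Icc_simplexLaw α m] with x hx i
  have := hx (i + 1) (by omega)
  simpa [pos] using this

end

/-! ### The covariance inequality: adding one label. -/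

/-- The one-variable part of the induction step. Here `F`, `g` and `X` stand for the conditional
means of `F`, `g` and `F g` given the split point `b`, and `C` for the conditional covariance of `F`
with the lower height, whose mean is `w₀`. -/
theorem covariance_bound_combine {ρ : Measure ℝ} [IsProbabilityMeasure ρ] {m c d p M A B w₀ : ℝ}
    (hb : ∀ᵐ b ∂ρ, b ∈ Set.Ioo (0 : ℝ) 1)
    (hm : ∫ b, b ∂ρ = m) (hc : 0 < c) (hd : 0 < d)
    (hdm : 4 * d ≤ ∫ b, |b - m| ∂ρ) (hcp : ρ.real (Set.Iio c) ≤ p)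
    (hA : 0 ≤ A) (hB : 0 ≤ B) (hw₀ : 0 ≤ w₀)
    {F g X C : ℝ → ℝ} (hF : Monotone F) (hF0 : ∀ b, 0 ≤ F b) (hFM : ∀ b, F b ≤ M)
    (hg : Measurable g) (hg0 : ∀ b, 0 ≤ g b) (hg1 : ∀ b, g b ≤ 1) (hX : Integrable X ρ)
    (hC : Integrable (fun b => b * C b) ρ) (hC0 : ∀ᵐ b ∂ρ, 0 ≤ C b)
    (hXC : ∀ᵐ b ∂ρ, X b - F b * g b ≤ A * C b + B * F b) (hXF : ∀ᵐ b ∂ρ, X b ≤ F b) :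
    0 ≤ ∫ b, b * C b ∂ρ + (1 + w₀) * ∫ b, F b * (b - m) ∂ρ ∧
      ∫ b, X b ∂ρ - (∫ b, F b ∂ρ) * ∫ b, g b ∂ρ ≤
        (A / c + 3 / d) * (∫ b, b * C b ∂ρ + (1 + w₀) * ∫ b, F b * (b - m) ∂ρ) +
          (B + p) * ∫ b, F b ∂ρ := by
  have hM : ∀ b, |F b| ≤ M := fun b => by rw [abs_of_nonneg (hF0 b)]; exact hFM b
  have hid : Integrable (fun b : ℝ => b) ρ := by
    refine Integrable.of_bound measurable_id.aestronglyMeasurable 1 ?_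
    filter_upwards [hb] with b hb
    rw [Real.norm_eq_abs, abs_of_pos hb.1]
    exact hb.2.le
  have hFi : Integrable F ρ := Integrable.of_bound hF.measurable.aestronglyMeasurable M
    (Filter.Eventually.of_forall hM)
  have hgi : Integrable g ρ := Integrable.of_bound hg.aestronglyMeasurable 1
    (Filter.Eventually.of_forall fun b => by
      rw [Real.norm_eq_abs, abs_of_nonneg (hg0 b)]; exact hg1 b)
  have hFg : Integrable (fun b => F b * g b) ρ :=
    hgi.bdd_mul hF.measurable.aestronglyMeasurable (Filter.Eventually.of_forall hM)
  have hL := integral_abs_sub_le_of_monotone hid hm hd hdm hF hM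
  set S := ∫ b, F b * (b - m) ∂ρ with hS
  set T := ∫ b, b * C b ∂ρ with hT
  set I : ℝ → ℝ := (Set.Iio c).indicator (fun _ => 1) with hI
  have hI0 : ∀ b, 0 ≤ I b := fun b => Set.indicator_nonneg (by simp) _
  have hIi : Integrable I ρ := (integrable_const 1).indicator measurableSet_Iio
  have hFI : Integrable (fun b => F b * I b) ρ :=
    hIi.bdd_mul hF.measurable.aestronglyMeasurable (Filter.Eventually.of_forall hM)
  have hS0 : 0 ≤ S := by
    have : 0 ≤ 3 / d * S := le_trans (integral_nonneg fun b => abs_nonneg _) hL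
    exact nonneg_of_mul_nonneg_right this (by positivity)
  have hT0 : 0 ≤ T := by
    refine integral_nonneg_of_ae ?_
    filter_upwards [hb, hC0] with b hb hC
    exact mul_nonneg hb.1.le hC
  have hFe : 0 ≤ ∫ b, F b ∂ρ := integral_nonneg hF0
  refine ⟨by positivity, ?_⟩
  have h1 : ∫ b, X b ∂ρ - ∫ b, F b * g b ∂ρ ≤ A / c * T + B * ∫ b, F b ∂ρ + p * ∫ b, F b ∂ρ := by
    have hi1 : Integrable (fun b => A / c * (b * C b) + B * F b) ρ :=
      (hC.const_mul _).add (hFi.const_mul _)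
    have : ∫ b, (X b - F b * g b) ∂ρ ≤ ∫ b, (A / c * (b * C b) + B * F b + F b * I b) ∂ρ := by
      refine integral_mono_ae (hX.sub hFg) (hi1.add hFI) ?_
      filter_upwards [hb, hC0, hXC, hXF] with b hb hC0 hXC hXF
      change X b - F b * g b ≤ A / c * (b * C b) + B * F b + F b * I b
      have hBF := mul_nonneg hB (hF0 b)
      -- Below `c` the trivial bound `X ≤ F` is charged to the indicator; above it, `1 ≤ b / c`
      -- restores the factor `b`.
      by_cases h : b < c
      · have e : I b = 1 := by simp [hI, h]
        rw [e]
        have := mul_nonneg (hF0 b) (hg0 b)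
        have : 0 ≤ A / c * (b * C b) := by
          have := hb.1
          positivity
        linarith
      · have e : I b = 0 := by simp [hI, h]
        rw [e]
        have : A * C b ≤ A / c * (b * C b) := by
          rw [div_mul_eq_mul_div, le_div_iff₀ hc]
          have : c * (A * C b) ≤ b * (A * C b) := by
            gcongr
            exact not_lt.1 h
          linarith
        linarith
    rw [integral_sub hX hFg, integral_add hi1 hFI,
      integral_add (hC.const_mul _) (hFi.const_mul _), integral_const_mul, integral_const_mul]
      at this
    have h2 := integral_mul_indicator_Iio_le (ρ := ρ) c hF hM
    have h3 : ρ.real (Set.Iio c) * ∫ b, F b ∂ρ ≤ p * ∫ b, F b ∂ρ := by gcongr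
    linarith
  have h2 : ∫ b, F b * g b ∂ρ - (∫ b, F b ∂ρ) * ∫ b, g b ∂ρ ≤ 3 / d * S := by
    refine le_trans ?_ hL
    set γ := ∫ b, g b ∂ρ with hγ
    have hγ0 : 0 ≤ γ := integral_nonneg hg0
    have hγ1 : γ ≤ 1 := by
      have := integral_mono hgi (integrable_const 1) hg1
      simpa using this
    -- As `g - γ` is centred, any constant may be subtracted from `F`; then `|g - γ| ≤ 1` leaves the
    -- `L¹` distance.
    have e : ∫ b, F b * g b ∂ρ - (∫ b, F b ∂ρ) * γ = ∫ b, (F b - F m) * (g b - γ) ∂ρ := by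
      have hi2 : Integrable (fun b => F b * g b - γ * F b) ρ := hFg.sub (hFi.const_mul γ)
      have hi3 : Integrable (fun b => F m * g b - F m * γ) ρ :=
        (hgi.const_mul (F m)).sub (integrable_const _)
      have : ∀ b, (F b - F m) * (g b - γ) = (F b * g b - γ * F b) - (F m * g b - F m * γ) :=
        fun b => by ring
      simp only [this]
      rw [integral_sub hi2 hi3, integral_sub hFg (hFi.const_mul γ),
        integral_sub (hgi.const_mul _) (integrable_const _), integral_const_mul,
        integral_const_mul, ← hγ]
      simp
      ring
    rw [e]
    have hi4 : Integrable (fun b => |F b - F m|) ρ := (hFi.sub (integrable_const (F m))).abs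
    refine (Real.le_norm_self _).trans (norm_integral_le_of_norm_le hi4 (Filter.Eventually.of_forall fun b => ?_))
    change |(F b - F m) * (g b - γ)| ≤ |F b - F m|
    rw [abs_mul]
    refine mul_le_of_le_one_right (abs_nonneg _) (abs_le.2 ⟨?_, ?_⟩)
    · linarith [hg0 b]
    · linarith [hg1 b]
  have h3 : 0 ≤ A / c + 3 / d := by positivity
  have h4 : 0 ≤ A / c * ((1 + w₀) * S) := by positivity
  have h5 : 0 ≤ 3 / d * (T + w₀ * S) := by positivity
  nlinarith

theorem glue_mono {p q : ℕ} {b : ℝ} (hb0 : 0 ≤ b) (hb1 : b ≤ 1) {v v' : Fin p → ℝ}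
    {w w' : Fin q → ℝ} (hv : v ≤ v') (hw : w ≤ w') : glue b v w ≤ glue b v' w' := by
  intro i
  have hb : 0 ≤ 1 - b := by linarith
  refine Fin.addCases (fun i => ?_) (fun i => ?_) i
  · simp only [glue, join, Fin.append_left]
    refine Fin.lastCases ?_ (fun i => ?_) i
    · simp
    · simpa using mul_le_mul_of_nonneg_left (hv i) hb0
  · simpa [glue, join, Fin.append_right] using mul_le_mul_of_nonneg_left (hw i) hb

/-- An upper point sits at `b + (1 - b) w = w + b (1 - w)`, which increases with `b` when `w ≤ 1`.
This is what makes the conditional mean of an increasing function increasing in the split point. -/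
theorem glue_mono_left {p q : ℕ} {b b' : ℝ} (hb : b ≤ b') {v : Fin p → ℝ} {w : Fin q → ℝ}
    (hv : ∀ i, 0 ≤ v i) (hw : ∀ i, w i ≤ 1) : glue b v w ≤ glue b' v w := by
  intro i
  refine Fin.addCases (fun i => ?_) (fun i => ?_) i
  · simp only [glue, join, Fin.append_left]
    refine Fin.lastCases ?_ (fun i => ?_) i
    · simpa using hb
    · simpa using mul_le_mul_of_nonneg_right hb (hv i)
  · have := hw i
    simp only [glue, join, Fin.append_right, Pi.smul_apply, smul_eq_mul]
    nlinarith

/-- Integration over a simplex, splitting off the points above a given one. -/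
theorem integral_simplexLaw_split {α : ℝ} (hα : 0 < α) (p q : ℕ)
    {F H : (Fin (p + 1 + q) → ℝ) → ℝ} {h : ℝ × (Fin p → ℝ) → ℝ}
    (hFm : Measurable F) (hHm : Measurable H)
    (hH : ∀ b v w, H (glue b v w) = h (b, v))
    (hi : Integrable (fun x => F x * H x) (simplexLaw α (p + 1 + q))) :
    Integrable (fun b => ∫ v, (∫ w, F (glue b v w) ∂simplexLaw α q) * h (b, v) ∂simplexLaw α p)
        (betaMeasure ((p + 1) * α) ((q + 1) * α)) ∧
      ∫ x, F x * H x ∂simplexLaw α (p + 1 + q) =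
        ∫ b, ∫ v, (∫ w, F (glue b v w) ∂simplexLaw α q) * h (b, v) ∂simplexLaw α p
          ∂betaMeasure ((p + 1) * α) ((q + 1) * α) := by
  have : IsProbabilityMeasure (betaMeasure ((p + 1) * α) ((q + 1) * α)) :=
      isProbabilityMeasureBeta (by positivity) (by positivity)
  have hmp := measurePreserving_glue hα p q
  have hi' : Integrable (fun z : (ℝ × (Fin p → ℝ)) × (Fin q → ℝ) =>
      F (glue z.1.1 z.1.2 z.2) * h z.1) (((betaMeasure ((p + 1) * α) ((q + 1) * α)).prod
        (simplexLaw α p)).prod (simplexLaw α q)) := by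
    have := hmp.integrable_comp_of_integrable hi
    simpa only [Function.comp_def, hH] using this
  have hi2 := hi'.integral_prod_left
  simp only [integral_mul_const] at hi2
  refine ⟨hi2.integral_prod_left, ?_⟩
  have hFH : Measurable fun x => F x * H x := hFm.mul hHm
  rw [← hmp.map_eq, integral_map hmp.measurable.aemeasurable hFH.aestronglyMeasurable]
  simp only [hH]
  rw [integral_prod _ hi']
  simp only [integral_mul_const]
  rw [integral_prod _ hi2]

/-- The total height of the points with labels `u 0, …, u (k - 1)`. -/
noncomputable def height (u : ℕ → ℕ) (k : ℕ) {m : ℕ} (x : Fin m → ℝ) : ℝ :=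
  ∑ i ∈ Finset.range k, pos 1 x (u i)

@[fun_prop]
theorem measurable_height (u : ℕ → ℕ) (k m : ℕ) : Measurable (height u k (m := m)) := by
  unfold height
  fun_prop

/-- The covariance of `F` with a test function `g` of the labelled points is controlled by that of
`F` with their total height. -/
def CovarianceBound (α : ℝ) (u : ℕ → ℕ) (k m : ℕ) (A B : ℝ) : Prop :=
  ∀ F : (Fin m → ℝ) → ℝ, Measurable F → Monotone F → (∀ x, 0 ≤ F x) →
    ∀ M : ℝ, (∀ x, F x ≤ M) →
    ∀ g : (Fin m → ℝ) → ℝ, Measurable g → (∀ x, 0 ≤ g x) → (∀ x, g x ≤ 1) →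
      (∀ x y, (∀ i < k, pos 1 x (u i) = pos 1 y (u i)) → g x = g y) →
      0 ≤ ∫ x, F x * height u k x ∂simplexLaw α m -
          (∫ x, F x ∂simplexLaw α m) * ∫ x, height u k x ∂simplexLaw α m ∧
        ∫ x, F x * g x ∂simplexLaw α m - (∫ x, F x ∂simplexLaw α m) * ∫ x, g x ∂simplexLaw α m ≤
          A * (∫ x, F x * height u k x ∂simplexLaw α m -
            (∫ x, F x ∂simplexLaw α m) * ∫ x, height u k x ∂simplexLaw α m) +
          B * ∫ x, F x ∂simplexLaw α m

theorem ae_height_mem_Icc (α : ℝ) {u : ℕ → ℕ} {k m : ℕ} (hu : ∀ i < k, u i ≤ m + 1) :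
    ∀ᵐ x ∂simplexLaw α m, height u k x ∈ Set.Icc (0 : ℝ) k := by
  filter_upwards [ae_pos_mem_Icc_simplexLaw α m] with x hx
  constructor
  · exact Finset.sum_nonneg fun i hi => (hx _ (hu i (Finset.mem_range.1 hi))).1
  · calc height u k x ≤ ∑ i ∈ Finset.range k, (1 : ℝ) :=
          Finset.sum_le_sum fun i hi => (hx _ (hu i (Finset.mem_range.1 hi))).2
      _ = k := by simp

theorem integrable_height {α : ℝ} (hα : 0 < α) {u : ℕ → ℕ} {k m : ℕ}
    (hu : ∀ i < k, u i ≤ m + 1) : Integrable (height u k) (simplexLaw α m) := by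
  have := isProbabilityMeasure_simplexLaw hα m
  refine Integrable.of_bound (measurable_height u k m).aestronglyMeasurable k ?_
  filter_upwards [ae_height_mem_Icc α hu] with x hx
  rw [Real.norm_eq_abs, abs_of_nonneg hx.1]
  exact hx.2

theorem CovarianceBound.mono {α : ℝ} {u : ℕ → ℕ} {k m : ℕ} {A B A' B' : ℝ}
    (h : CovarianceBound α u k m A B) (hA : A ≤ A') (hB : B ≤ B') :
    CovarianceBound α u k m A' B' := by
  intro F hFm hF hF0 M hFM g hg hg0 hg1 hgu
  obtain ⟨h1, h2⟩ := h F hFm hF hF0 M hFM g hg hg0 hg1 hgu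
  refine ⟨h1, h2.trans ?_⟩
  have : 0 ≤ ∫ x, F x ∂simplexLaw α m := integral_nonneg hF0
  gcongr

theorem CovarianceBound.of_label_eq_zero {α : ℝ} (hα : 0 < α) {u : ℕ → ℕ} {k m : ℕ} {A B : ℝ}
    (hB : 0 ≤ B) (hu : ∀ i < k, u i = 0) : CovarianceBound α u k m A B := by
  intro F hFm hF hF0 M hFM g hg hg0 hg1 hgu
  have := isProbabilityMeasure_simplexLaw hα m
  have hh : ∀ x : Fin m → ℝ, height u k x = 0 := fun x =>
    Finset.sum_eq_zero fun i hi => by rw [hu i (Finset.mem_range.1 hi), pos_zero]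
  have hg' : ∀ x, g x = g 0 := fun x => hgu x 0 fun i hi => by rw [hu i hi, pos_zero, pos_zero]
  have : 0 ≤ ∫ x, F x ∂simplexLaw α m := integral_nonneg hF0
  simp only [hh, hg', integral_mul_const, integral_const, probReal_univ, smul_eq_mul]
  constructor
  · simp
  · have := mul_nonneg hB this
    linarith

/-- A label at the right endpoint has deterministic position, so it shifts the height by a constant
and gives `g` no information. -/
theorem CovarianceBound.of_label_eq_last {α : ℝ} (hα : 0 < α) {u : ℕ → ℕ} {k m : ℕ} {A B : ℝ}
    (hu : ∀ i < k, u i ≤ m + 1) (huk : u k = m + 1)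
    (h : CovarianceBound α u k m A B) : CovarianceBound α u (k + 1) m A B := by
  intro F hFm hF hF0 M hFM g hg hg0 hg1 hgu
  have := isProbabilityMeasure_simplexLaw hα m
  have hFi : Integrable F (simplexLaw α m) := Integrable.of_bound hFm.aestronglyMeasurable M
    (Filter.Eventually.of_forall fun x => by
      rw [Real.norm_eq_abs, abs_of_nonneg (hF0 x)]
      exact hFM x)
  have hhi := integrable_height hα hu
  have hFh : Integrable (fun x => F x * height u k x) (simplexLaw α m) :=
    hhi.bdd_mul hFm.aestronglyMeasurable (Filter.Eventually.of_forall fun x => by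
      rw [Real.norm_eq_abs, abs_of_nonneg (hF0 x)]
      exact hFM x)
  have hh : ∀ x : Fin m → ℝ, height u (k + 1) x = height u k x + 1 := fun x => by
    rw [height, Finset.sum_range_succ, huk, pos_of_lt _ _ (by omega)]
    rfl
  have e : ∫ x, F x * height u (k + 1) x ∂simplexLaw α m -
      (∫ x, F x ∂simplexLaw α m) * ∫ x, height u (k + 1) x ∂simplexLaw α m =
      ∫ x, F x * height u k x ∂simplexLaw α m -
        (∫ x, F x ∂simplexLaw α m) * ∫ x, height u k x ∂simplexLaw α m := by
    simp only [hh, mul_add, mul_one]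
    rw [integral_add hFh hFi, integral_add hhi (integrable_const 1)]
    simp only [integral_const, probReal_univ, smul_eq_mul]
    ring
  rw [e]
  refine h F hFm hF hF0 M hFM g hg hg0 hg1 fun x y hxy => hgu x y fun i hi => ?_
  rcases Nat.lt_succ_iff_lt_or_eq.1 hi with hi | rfl
  · exact hxy i hi
  · rw [huk, pos_of_lt _ _ (by omega), pos_of_lt _ _ (by omega)]

theorem CovarianceBound.split {α : ℝ} (hα : 0 < α) {u : ℕ → ℕ} {k p q : ℕ} {A B c d r : ℝ}
    (hu : ∀ i < k, u i ≤ p + 1) (huk : u k = p + 1) (hc : 0 < c) (hd : 0 < d) (hA : 0 ≤ A)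
    (hB : 0 ≤ B)
    (hdm : 4 * d ≤ ∫ b, |b - (p + 1) * α / ((p + 1) * α + (q + 1) * α)|
      ∂betaMeasure ((p + 1) * α) ((q + 1) * α))
    (hcr : (betaMeasure ((p + 1) * α) ((q + 1) * α)).real (Set.Iio c) ≤ r)
    (h : CovarianceBound α u k p A B) :
    CovarianceBound α u (k + 1) (p + 1 + q) (A / c + 3 / d) (B + r) := by
  intro F hFm hF hF0 M hFM g hg hg0 hg1 hgu
  have hs0 : 0 < (p + 1) * α := by positivity
  have ht0 : 0 < (q + 1) * α := by positivity
  have := isProbabilityMeasure_simplexLaw hα p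
  have := isProbabilityMeasure_simplexLaw hα q
  have := isProbabilityMeasure_simplexLaw hα (p + 1 + q)
  have : IsProbabilityMeasure (betaMeasure ((p + 1) * α) ((q + 1) * α)) :=
      isProbabilityMeasureBeta hs0 ht0
  set ρ := betaMeasure ((p + 1) * α) ((q + 1) * α) with hρ
  set m := (p + 1) * α / ((p + 1) * α + (q + 1) * α) with hmdef
  have hm : ∫ b, b ∂ρ = m := integral_id_betaMeasure hs0 ht0
  have hb : ∀ᵐ b ∂ρ, b ∈ Set.Ioo (0 : ℝ) 1 := ae_mem_Ioo_betaMeasure _ _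
  have hFabs : ∀ x, ‖F x‖ ≤ M := fun x => by
    rw [Real.norm_eq_abs, abs_of_nonneg (hF0 x)]
    exact hFM x
  have hgabs : ∀ x, ‖g x‖ ≤ 1 := fun x => by
    rw [Real.norm_eq_abs, abs_of_nonneg (hg0 x)]
    exact hg1 x
  have hM0 : 0 ≤ M := (hF0 0).trans (hFM 0)
  -- integration over the points above the split point
  set F₁ : ℝ → (Fin p → ℝ) → ℝ := fun b v => ∫ w, F (glue b v w) ∂simplexLaw α q with hF₁
  have hF₁m : Measurable fun z : ℝ × (Fin p → ℝ) => F₁ z.1 z.2 := by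
    have h1 : Measurable fun z : (ℝ × (Fin p → ℝ)) × (Fin q → ℝ) => F (glue z.1.1 z.1.2 z.2) :=
      hFm.comp (by fun_prop)
    exact h1.stronglyMeasurable.integral_prod_right'.measurable
  have hFgi : ∀ b v, Integrable (fun w => F (glue b v w)) (simplexLaw α q) := fun b v =>
    Integrable.of_bound (hFm.comp (by fun_prop)).aestronglyMeasurable M
      (Filter.Eventually.of_forall fun w => hFabs _)
  have hF₁0 : ∀ b v, 0 ≤ F₁ b v := fun b v => integral_nonneg fun w => hF0 _
  have hF₁M : ∀ b v, F₁ b v ≤ M := fun b v => by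
    have := integral_mono (hFgi b v) (integrable_const M) fun w => hFM _
    simpa using this
  have hF₁i : ∀ b, Integrable (F₁ b) (simplexLaw α p) := fun b =>
    Integrable.of_bound (hF₁m.comp measurable_prodMk_left).aestronglyMeasurable M
      (Filter.Eventually.of_forall fun v => by
        rw [Real.norm_eq_abs, abs_of_nonneg (hF₁0 b v)]
        exact hF₁M b v)
  -- integration over all points but the split point
  set F₂ : ℝ → ℝ := fun b => ∫ v, F₁ b v ∂simplexLaw α p with hF₂
  have hF₂mono : MonotoneOn F₂ (Set.Icc 0 1) := by
    intro b _ b' _ hbb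
    refine integral_mono_ae (hF₁i b) (hF₁i b') ?_
    filter_upwards [ae_mem_Icc_simplexLaw α p] with v hv
    refine integral_mono_ae (hFgi b v) (hFgi b' v) ?_
    filter_upwards [ae_mem_Icc_simplexLaw α q] with w hw
    exact hF (glue_mono_left hbb (fun i => (hv i).1) fun i => (hw i).2)
  -- `F₂` is monotone only on `[0, 1]`; the constant extension is monotone on the line and agrees
  -- with it almost surely.
  set F₃ : ℝ → ℝ := fun b => F₂ (Set.projIcc (0 : ℝ) 1 zero_le_one b) with hF₃
  have hF₃mono : Monotone F₃ := fun b b' hbb =>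
    hF₂mono (Set.projIcc (0 : ℝ) 1 zero_le_one b).2 (Set.projIcc (0 : ℝ) 1 zero_le_one b').2
      (Set.monotone_projIcc zero_le_one hbb)
  have hF₂₃ : ∀ b ∈ Set.Ioo (0 : ℝ) 1, F₃ b = F₂ b := fun b hb => by
    simp only [hF₃]
    rw [Set.projIcc_of_mem zero_le_one ⟨hb.1.le, hb.2.le⟩]
  have hF₃ae : ∀ᵐ b ∂ρ, F₃ b = F₂ b := hb.mono hF₂₃
  have hF₃0 : ∀ b, 0 ≤ F₃ b := fun b => integral_nonneg fun v => hF₁0 _ v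
  have hF₃M : ∀ b, F₃ b ≤ M := fun b => by
    have := integral_mono (hF₁i (Set.projIcc (0 : ℝ) 1 zero_le_one b)) (integrable_const M)
      fun v => hF₁M _ v
    simpa using this
  -- the test function
  set g₁ : ℝ → (Fin p → ℝ) → ℝ := fun b v => g (glue b v 0) with hg₁
  have hg₁m : Measurable fun z : ℝ × (Fin p → ℝ) => g₁ z.1 z.2 := hg.comp (by fun_prop)
  have hgg : ∀ (b : ℝ) (v : Fin p → ℝ) (w : Fin q → ℝ), g (glue b v w) = g₁ b v := fun b v w =>
    hgu _ _ fun i hi => by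
      have : u i ≤ p + 1 := by
        rcases Nat.lt_succ_iff_lt_or_eq.1 hi with hi | rfl
        · exact hu i hi
        · exact huk.le
      rw [pos_glue_left _ _ _ this, pos_glue_left _ _ _ this]
  have hg₁i : ∀ b, Integrable (g₁ b) (simplexLaw α p) := fun b =>
    Integrable.of_bound (hg₁m.comp measurable_prodMk_left).aestronglyMeasurable 1
      (Filter.Eventually.of_forall fun v => hgabs _)
  set g₂ : ℝ → ℝ := fun b => ∫ v, g₁ b v ∂simplexLaw α p with hg₂
  have hg₂m : Measurable g₂ := hg₁m.stronglyMeasurable.integral_prod_right'.measurable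
  have hg₂0 : ∀ b, 0 ≤ g₂ b := fun b => integral_nonneg fun v => hg0 _
  have hg₂1 : ∀ b, g₂ b ≤ 1 := fun b => by
    have := integral_mono (hg₁i b) (integrable_const 1) fun v => hg1 _
    simpa using this
  -- the height
  have hhh : ∀ (b : ℝ) (v : Fin p → ℝ) (w : Fin q → ℝ),
      height u (k + 1) (glue b v w) = b * (height u k v + 1) := fun b v w => by
    rw [height, Finset.sum_range_succ, huk, pos_glue_left _ _ _ le_rfl,
      pos_of_lt 1 v (Nat.lt_succ_self p), mul_add, height, Finset.mul_sum]
    congr 1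
    exact Finset.sum_congr rfl fun i hi => pos_glue_left _ _ _ (hu i (Finset.mem_range.1 hi))
  have hhi := integrable_height hα hu
  have hhi' : Integrable (height u (k + 1)) (simplexLaw α (p + 1 + q)) :=
    integrable_height hα fun i hi => by
      rcases Nat.lt_succ_iff_lt_or_eq.1 hi with hi | rfl
      · exact (hu i hi).trans (by omega)
      · omega
  set w₀ := ∫ v, height u k v ∂simplexLaw α p with hw₀
  have hw₀0 : 0 ≤ w₀ := by
    refine integral_nonneg_of_ae ?_
    filter_upwards [ae_height_mem_Icc α hu] with v hv
    exact hv.1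
  have hF₁h : ∀ b, Integrable (fun v => F₁ b v * height u k v) (simplexLaw α p) := fun b =>
    hhi.bdd_mul (hF₁i b).aestronglyMeasurable (Filter.Eventually.of_forall fun v => by
        rw [Real.norm_eq_abs, abs_of_nonneg (hF₁0 b v)]
        exact hF₁M b v)
  have hF₁g : ∀ b, Integrable (fun v => F₁ b v * g₁ b v) (simplexLaw α p) := fun b =>
    (hg₁i b).bdd_mul (hF₁i b).aestronglyMeasurable (Filter.Eventually.of_forall fun v => by
        rw [Real.norm_eq_abs, abs_of_nonneg (hF₁0 b v)]
        exact hF₁M b v)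
  set X : ℝ → ℝ := fun b => ∫ v, F₁ b v * g₁ b v ∂simplexLaw α p with hX
  set C : ℝ → ℝ := fun b => ∫ v, F₁ b v * height u k v ∂simplexLaw α p - F₂ b * w₀ with hC
  have hgi : Integrable g (simplexLaw α (p + 1 + q)) :=
    Integrable.of_bound hg.aestronglyMeasurable 1 (Filter.Eventually.of_forall hgabs)
  -- splitting all the integrals
  obtain ⟨iF, eF⟩ := integral_simplexLaw_split hα p q (F := F) (H := fun _ => 1)
    (h := fun _ => 1) hFm measurable_const (fun _ _ _ => rfl)
    ((integrable_const M).mono' (hFm.mul measurable_const).aestronglyMeasurable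
      (Filter.Eventually.of_forall fun x => by simpa using hFabs x))
  obtain ⟨iX, eX⟩ := integral_simplexLaw_split hα p q (F := F) (H := g)
    (h := fun z => g₁ z.1 z.2) hFm hg hgg
    (hgi.bdd_mul
      hFm.aestronglyMeasurable (Filter.Eventually.of_forall hFabs))
  obtain ⟨-, eg⟩ := integral_simplexLaw_split hα p q (F := fun _ => 1) (H := g)
    (h := fun z => g₁ z.1 z.2) measurable_const hg hgg
    (by simpa using hgi)
  obtain ⟨iW, eW⟩ := integral_simplexLaw_split hα p q (F := F) (H := height u (k + 1))
    (h := fun z => z.1 * (height u k z.2 + 1)) hFm (measurable_height _ _ _) hhh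
    (hhi'.bdd_mul hFm.aestronglyMeasurable (Filter.Eventually.of_forall hFabs))
  obtain ⟨-, eh⟩ := integral_simplexLaw_split hα p q (F := fun _ => 1) (H := height u (k + 1))
    (h := fun z => z.1 * (height u k z.2 + 1)) measurable_const (measurable_height _ _ _) hhh
    (by simpa using hhi')
  simp only [mul_one, one_mul, integral_const, probReal_univ, smul_eq_mul] at iF eF eX eg eh
  change Integrable F₂ ρ at iF
  change _ = ∫ b, F₂ b ∂ρ at eF
  change Integrable X ρ at iX
  change _ = ∫ b, X b ∂ρ at eX
  change _ = ∫ b, g₂ b ∂ρ at eg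
  have eF₃ : ∫ b, F₂ b ∂ρ = ∫ b, F₃ b ∂ρ := integral_congr_ae (hF₃ae.mono fun b hb => hb.symm)
  have hCb : ∀ b, ∫ v, F₁ b v * (b * (height u k v + 1)) ∂simplexLaw α p =
      b * C b + (1 + w₀) * (F₂ b * b) := fun b => by
    have : ∀ v, F₁ b v * (b * (height u k v + 1)) = b * (F₁ b v * height u k v) + b * F₁ b v :=
      fun v => by ring
    simp only [this]
    rw [integral_add ((hF₁h b).const_mul b) ((hF₁i b).const_mul b), integral_const_mul,
      integral_const_mul]
    simp only [hC, hF₂]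
    ring
  have hid : Integrable (fun b : ℝ => b) ρ :=
    integrable_of_continuous_betaMeasure hs0 ht0 continuous_id
  have hF₂b : Integrable (fun b => F₂ b * b) ρ :=
    hid.bdd_mul iF.aestronglyMeasurable (c := M) (hb.mono fun b hb => by
      rw [← hF₂₃ b hb, Real.norm_eq_abs, abs_of_nonneg (hF₃0 b)]
      exact hF₃M b)
  change Integrable (fun b => ∫ v, F₁ b v * (b * (height u k v + 1)) ∂simplexLaw α p) ρ at iW
  change _ = ∫ b, ∫ v, F₁ b v * (b * (height u k v + 1)) ∂simplexLaw α p ∂ρ at eW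
  simp only [hCb] at iW eW
  have iC : Integrable (fun b => b * C b) ρ := by
    have := iW.sub (hF₂b.const_mul (1 + w₀))
    refine this.congr (Filter.Eventually.of_forall fun b => ?_)
    simp
  rw [integral_add iC (hF₂b.const_mul _), integral_const_mul] at eW
  have ehm : ∫ x, height u (k + 1) x ∂simplexLaw α (p + 1 + q) = m * (w₀ + 1) := by
    rw [eh, ← hm, ← integral_mul_const]
    congr 1 with b
    rw [integral_const_mul, integral_add hhi (integrable_const 1)]
    simp [hw₀]
  have eS : ∫ b, F₃ b * (b - m) ∂ρ = ∫ b, F₂ b * b ∂ρ - m * ∫ b, F₂ b ∂ρ := by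
    rw [← integral_const_mul, ← integral_sub hF₂b (iF.const_mul m)]
    refine integral_congr_ae (hF₃ae.mono fun b hb => ?_)
    simp only [hb]
    ring
  have ecov : ∫ x, F x * height u (k + 1) x ∂simplexLaw α (p + 1 + q) -
      (∫ x, F x ∂simplexLaw α (p + 1 + q)) * ∫ x, height u (k + 1) x ∂simplexLaw α (p + 1 + q) =
      ∫ b, b * C b ∂ρ + (1 + w₀) * ∫ b, F₃ b * (b - m) ∂ρ := by
    rw [eW, ehm, eF, eS]
    ring
  rw [ecov, eX, eg, eF, eF₃]
  have hstep : ∀ b ∈ Set.Ioo (0 : ℝ) 1, 0 ≤ C b ∧ X b - F₂ b * g₂ b ≤ A * C b + B * F₂ b := by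
    intro b hb
    refine h (F₁ b) (hF₁m.comp measurable_prodMk_left) (fun v v' hv => ?_) (hF₁0 b) M (hF₁M b)
      (g₁ b) (hg₁m.comp measurable_prodMk_left) (fun v => hg0 _) (fun v => hg1 _)
      fun v v' hv => hgu _ _ fun i hi => ?_
    · exact integral_mono (hFgi b v) (hFgi b v') fun w => hF (glue_mono hb.1.le hb.2.le hv le_rfl)
    -- For fixed `b`, the label `u k` is the fixed right endpoint of the lower configuration, so `g₁
    -- b` depends only on the first `k` labels.
    · rcases Nat.lt_succ_iff_lt_or_eq.1 hi with hi | rfl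
      · rw [pos_glue_left _ _ _ (hu i hi), pos_glue_left _ _ _ (hu i hi), hv i hi]
      · rw [pos_glue_left _ _ _ huk.le, pos_glue_left _ _ _ huk.le, huk, pos_of_lt _ _ (by omega),
          pos_of_lt _ _ (by omega)]
  refine covariance_bound_combine hb hm hc hd hdm hcr hA hB hw₀0 hF₃mono hF₃0 hF₃M hg₂m hg₂0 hg₂1
    iX iC ?_ ?_ ?_
  · filter_upwards [hb] with b hb
    exact (hstep b hb).1
  · filter_upwards [hb] with b hb
    rw [hF₂₃ b hb]
    exact (hstep b hb).2
  · filter_upwards [hb] with b hb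
    rw [hF₂₃ b hb]
    exact integral_mono (hF₁g b) (hF₁i b) fun v => mul_le_of_le_one_right (hF₁0 b v) (hg1 _)

/-! ### Iteration over the labels. -/

/-- The constants in the covariance bound for `k` labels. -/
noncomputable def covarianceConst (c d : ℝ) : ℕ → ℝ
  | 0 => 0
  | k + 1 => covarianceConst c d k / c + 3 / d

theorem covarianceConst_nonneg {c d : ℝ} (hc : 0 < c) (hd : 0 < d) (k : ℕ) :
    0 ≤ covarianceConst c d k := by
  induction k with
  | zero => exact le_rfl
  | succ k ih =>
    rw [covarianceConst]
    positivity

/-- With `c` fixed, the constant is linear in `1/d`; hence the growth like `√N` once `d` is of order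
`N^{-1/2}`. -/
theorem covarianceConst_eq (c d : ℝ) (k : ℕ) :
    covarianceConst c d k = covarianceConst c 1 k / d := by
  induction k with
  | zero => simp [covarianceConst]
  | succ k ih =>
    rw [covarianceConst, covarianceConst, ih]
    ring

/-- The induction runs over configurations that end at label `u k`. Passing to `u (k + 1)` makes `u
k` an interior split point, unless it is `0` or equals the new endpoint, in which case it carries no
randomness. -/
theorem covarianceBound_of_beta {α : ℝ} (hα : 0 < α) {u : ℕ → ℕ} (hu : Monotone u) {K : ℕ}
    {c d r : ℝ} (hc : 0 < c) (hc1 : c ≤ 1) (hd : 0 < d) (hr : 0 ≤ r) (hu0 : u 0 = 0)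
    (hbeta : ∀ k < K, ∀ p q : ℕ, u k = p + 1 → u (k + 1) = p + 1 + q + 1 →
      4 * d ≤ ∫ b, |b - (p + 1) * α / ((p + 1) * α + (q + 1) * α)|
        ∂betaMeasure ((p + 1) * α) ((q + 1) * α) ∧
      (betaMeasure ((p + 1) * α) ((q + 1) * α)).real (Set.Iio c) ≤ r) :
    ∀ k ≤ K, ∀ m, u k = m + 1 → CovarianceBound α u k m (covarianceConst c d k) (k * r) := by
  intro k
  induction k with
  | zero =>
    intro _ m hm
    omega
  | succ k ih =>
    intro hk m hm
    have hle : ∀ i < k, u i ≤ u k := fun i hi => hu hi.le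
    have hA := covarianceConst_nonneg hc hd k
    have hkr : 0 ≤ (k : ℝ) * r := by positivity
    rcases Nat.eq_zero_or_pos (u k) with h0 | h0
    · refine CovarianceBound.of_label_eq_zero hα (by positivity) fun i hi => ?_
      have := hu (Nat.lt_succ_iff.1 hi)
      omega
    obtain ⟨p, hp⟩ : ∃ p, u k = p + 1 := ⟨u k - 1, by omega⟩
    have hkk := hu (Nat.le_succ k)
    rw [hm, hp] at hkk
    have IH := ih (by omega) p hp
    rw [covarianceConst]
    push_cast
    rcases eq_or_lt_of_le hkk with heq | hlt
    · obtain rfl : p = m := by omega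
      refine (CovarianceBound.of_label_eq_last hα (fun i hi => (hle i hi).trans hp.le) hp IH).mono
        ?_ (by linarith)
      have : covarianceConst c d k ≤ covarianceConst c d k / c := le_div_self hA hc hc1
      have : 0 < 3 / d := by positivity
      linarith
    · obtain ⟨q, rfl⟩ : ∃ q, m = p + 1 + q := ⟨m - (p + 1), by omega⟩
      obtain ⟨h1, h2⟩ := hbeta k (by omega) p q hp hm
      have := CovarianceBound.split hα (fun i hi => (hle i hi).trans hp.le) hp hc hd hA hkr h1 h2 IH
      exact this.mono le_rfl (by linarith)

/-! ### From the equilibrium measure to the unit simplex. -/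

open Filter Topology

theorem prod_Icc_one_eq_prod_range {β : Type*} [CommMonoid β] (f : ℕ → β) (n : ℕ) :
    ∏ i ∈ Finset.Icc 1 n, f i = ∏ i ∈ Finset.range n, f (i + 1) :=
  Finset.prod_nbij' (fun i => i - 1) (fun i => i + 1)
    (fun i hi => by simp only [Finset.mem_Icc, Finset.mem_range] at *; omega)
    (fun i hi => by simp only [Finset.mem_Icc, Finset.mem_range] at *; omega)
    (fun i hi => by simp only [Finset.mem_Icc] at *; omega) (fun i hi => by simp)
    (fun i hi => by
      simp only [Finset.mem_Icc] at hi
      rw [Nat.sub_add_cancel hi.1])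

theorem position_eq_pos (m : ℕ) (x : Fin m → ℝ) (k : ℕ) :
    position (m + 1) x k = pos ((m + 1 : ℕ) : ℝ) x k := rfl

theorem mem_Omega_iff (m : ℕ) (x : Fin m → ℝ) :
    x ∈ Omega (m + 1) ↔ ∀ i < m + 1,
      pos ((m + 1 : ℕ) : ℝ) x i ≤ pos ((m + 1 : ℕ) : ℝ) x (i + 1) := by
  constructor
  · intro h i hi
    have := h (i + 1) (Finset.mem_Icc.2 ⟨by omega, by omega⟩)
    rwa [Nat.add_sub_cancel] at this
  · intro h i hi
    have hi := Finset.mem_Icc.1 hi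
    have := h (i - 1) (by omega)
    rwa [Nat.sub_add_cancel hi.1] at this

theorem measurableSet_Omega (m : ℕ) :
    MeasurableSet (Omega (m + 1) : Set (Fin m → ℝ)) := by
  have : (Omega (m + 1) : Set (Fin m → ℝ)) = ⋂ i ∈ Finset.range (m + 1), {x : Fin m → ℝ |
      pos ((m + 1 : ℕ) : ℝ) x i ≤ pos ((m + 1 : ℕ) : ℝ) x (i + 1)} := by
    ext x
    rw [mem_Omega_iff]
    simp
  rw [this]
  exact Finset.measurableSet_biInter _ fun i _ => measurableSet_le (by fun_prop) (by fun_prop)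

theorem indicator_equilibriumDensity {α : ℝ} (m : ℕ) (x : Fin m → ℝ) :
    (Omega (m + 1) : Set (Fin m → ℝ)).indicator
        (fun x => ENNReal.ofReal (equilibriumDensity (m + 1) α x)) x =
      ENNReal.ofReal ((partition α m)⁻¹ * (((m + 1 : ℕ) : ℝ) ^ ((m + 1) * α - 1))⁻¹) *
        weight α ((m + 1 : ℕ) : ℝ) x := by
  by_cases hx : x ∈ (Omega (m + 1) : Set (Fin m → ℝ))
  · rw [Set.indicator_of_mem hx]
    have hx' := (mem_Omega_iff m x).1 hx
    have h1 : weight α ((m + 1 : ℕ) : ℝ) x = ENNReal.ofReal (∏ i ∈ Finset.range (m + 1),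
        (pos ((m + 1 : ℕ) : ℝ) x (i + 1) - pos ((m + 1 : ℕ) : ℝ) x i) ^ (α - 1)) := by
      rw [ENNReal.ofReal_prod_of_nonneg fun i hi => Real.rpow_nonneg
        (sub_nonneg.2 (hx' i (Finset.mem_range.1 hi))) _]
      refine Finset.prod_congr rfl fun i hi => ?_
      rw [gapWeight, if_pos (sub_nonneg.2 (hx' i (Finset.mem_range.1 hi)))]
    rw [h1, ← ENNReal.ofReal_mul' (Finset.prod_nonneg fun i hi => Real.rpow_nonneg
        (sub_nonneg.2 (hx' i (Finset.mem_range.1 hi))) _)]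
    congr 1
    unfold equilibriumDensity
    rw [prod_Icc_one_eq_prod_range]
    simp only [position_eq_pos, Nat.add_sub_cancel]
    congr 1
    unfold partition
    push_cast
    rw [inv_div, div_mul_eq_div_div]
    rfl
  · rw [Set.indicator_of_notMem hx]
    have : weight α ((m + 1 : ℕ) : ℝ) x = 0 := by
      by_contra h
      exact hx ((mem_Omega_iff m x).2 fun i hi => pos_le_pos_of_weight_ne_zero h hi)
    rw [this, mul_zero]

theorem lintegral_equilibrium {α : ℝ} (m : ℕ) {G : (Fin m → ℝ) → ENNReal} (hG : Measurable G) :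
    ∫⁻ x, G x ∂(equilibrium (m + 1) α : Measure (Fin m → ℝ)) =
      ∫⁻ x, G (((m + 1 : ℕ) : ℝ) • x) ∂simplexLaw α m := by
  have hN : (0 : ℝ) < ((m + 1 : ℕ) : ℝ) := by positivity
  have h1 : (equilibrium (m + 1) α : Measure (Fin m → ℝ)) =
      volume.withDensity fun x => ENNReal.ofReal ((partition α m)⁻¹ *
        (((m + 1 : ℕ) : ℝ) ^ ((m + 1) * α - 1))⁻¹) * weight α ((m + 1 : ℕ) : ℝ) x := by
    have h2 : (equilibrium (m + 1) α : Measure (Fin m → ℝ)) =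
      volume.withDensity ((Omega (m + 1) : Set (Fin m → ℝ)).indicator
        (fun x => ENNReal.ofReal (equilibriumDensity (m + 1) α x))) :=
      (withDensity_indicator (measurableSet_Omega m) _).symm
    rw [h2]
    congr 1 with x
    exact indicator_equilibriumDensity m x
  refine (congrArg (fun ν : Measure (Fin m → ℝ) => ∫⁻ x, G x ∂ν) h1).trans ?_
  rw [lintegral_withDensity_eq_lintegral_mul _ (by fun_prop) hG]
  simp only [Pi.mul_apply, mul_assoc]
  rw [lintegral_const_mul _ (by fun_prop), lintegral_weight_smul α hN m hG,
    lintegral_simplexLaw α m (by fun_prop), ← mul_assoc, ← ENNReal.ofReal_mul'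
    (by positivity), mul_assoc, inv_mul_cancel₀ (by positivity), mul_one]

theorem equilibrium_eq_map {α : ℝ} (m : ℕ) :
    (equilibrium (m + 1) α : Measure (Fin m → ℝ)) =
      (simplexLaw α m).map fun x => ((m + 1 : ℕ) : ℝ) • x := by
  refine Measure.ext_of_lintegral _ fun G hG => ?_
  rw [lintegral_equilibrium m hG, lintegral_map hG (by fun_prop)]

/-! ### Regularization of increasing densities. -/

/-- An increasing function agrees almost everywhere with a Borel measurable increasing one. -/
theorem exists_measurable_monotone_ae_eq {ι : Type*} [Fintype ι] {f : (ι → ℝ) → ENNReal}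
    (hf : Monotone f) : ∃ g : (ι → ℝ) → ENNReal, Measurable g ∧ Monotone g ∧ g =ᵐ[volume] f := by
  -- The supremum over strictly smaller points is lower semicontinuous, hence Borel.
  refine ⟨fun x => ⨆ z : {z : ι → ℝ // ∀ i, z i < x i}, f z, ?_, ?_, ?_⟩
  · refine measurable_of_Ioi fun a => IsOpen.measurableSet ?_
    have : (fun x : ι → ℝ => ⨆ z : {z : ι → ℝ // ∀ i, z i < x i}, f z) ⁻¹' Set.Ioi a =
        ⋃ z ∈ {z | a < f z}, Set.univ.pi fun i => Set.Ioi (z i) := by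
      ext x
      simp only [Set.mem_preimage, Set.mem_Ioi, lt_iSup_iff, Subtype.exists, Set.mem_iUnion,
        Set.mem_ofPred_eq, Set.mem_pi, Set.mem_univ, true_imp_iff]
      constructor
      · rintro ⟨z, h1, h2⟩
        exact ⟨z, h2, h1⟩
      · rintro ⟨z, h2, h1⟩
        exact ⟨z, h1, h2⟩
    rw [this]
    exact isOpen_biUnion fun z _ => isOpen_set_pi Set.finite_univ fun i _ => isOpen_Ioi
  · intro x y hxy
    exact iSup_le fun z => le_iSup (fun z : {z : ι → ℝ // ∀ i, z i < y i} => f z)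
      ⟨z, fun i => (z.2 i).trans_le (hxy i)⟩
  -- Superlevel sets of `f` are upper sets, whose frontiers are null. Off the frontiers at rational
  -- levels, any level exceeded at `x` is still exceeded slightly below `x` in all coordinates.
  · have hU : ∀ q : ℚ, IsUpperSet {x | ((Real.toNNReal q : NNReal) : ENNReal) < f x} :=
      fun q x y hxy hx => lt_of_lt_of_le hx (hf hxy)
    have h : ∀ᵐ x : ι → ℝ, ∀ q : ℚ,
        x ∉ frontier {x | ((Real.toNNReal q : NNReal) : ENNReal) < f x} :=
      ae_all_iff.2 fun q => measure_eq_zero_iff_ae_notMem.1 (hU q).null_frontier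
    filter_upwards [h] with x hx
    refine le_antisymm (iSup_le fun z => hf fun i => (z.2 i).le) (le_of_not_gt fun hlt => ?_)
    obtain ⟨q, -, hq1, hq2⟩ := ENNReal.lt_iff_exists_rat_btwn.1 hlt
    have hint : x ∈ interior {x | ((Real.toNNReal q : NNReal) : ENNReal) < f x} := by
      by_contra hni
      exact hx q ⟨subset_closure hq2, hni⟩
    have hcont : Tendsto (fun t : ℝ => fun i => x i - t) (𝓝[>] 0) (𝓝 x) := by
      have : Continuous fun t : ℝ => fun i => x i - t := by fun_prop
      have h2 := this.tendsto 0
      simp only [sub_zero] at h2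
      exact h2.mono_left nhdsWithin_le_nhds
    have hev := (hcont.eventually (mem_interior_iff_mem_nhds.1 hint)).and self_mem_nhdsWithin
    obtain ⟨t, ht, ht0⟩ := hev.exists
    have ht0 : 0 < t := ht0
    have : f (fun i => x i - t) ≤ ⨆ z : {z : ι → ℝ // ∀ i, z i < x i}, f z :=
      le_iSup (fun z : {z : ι → ℝ // ∀ i, z i < x i} => f z) ⟨fun i => x i - t, fun i => by
        simpa using ht0⟩
    exact absurd (ht.trans_le this) (not_lt.2 hq1.le)

/-- A probability measure with an increasing density is the rescaling of one with a Borel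
measurable increasing density on the unit simplex. -/
theorem exists_density_simplexLaw {α : ℝ} {m : ℕ} {μ : Measure (Fin m → ℝ)}
    (hμ : μ ∈ IncreasingDensity (m + 1) α) :
    ∃ f : (Fin m → ℝ) → ENNReal, Measurable f ∧ Monotone f ∧
      ∫⁻ x, f x ∂simplexLaw α m = 1 ∧
      μ = ((simplexLaw α m).withDensity f).map fun x => ((m + 1 : ℕ) : ℝ) • x := by
  obtain ⟨hprob, φ, hφ, hμφ⟩ : IsProbabilityMeasure μ ∧ ∃ φ : (Fin m → ℝ) → ENNReal,
      MonotoneOn φ (Omega (m + 1) : Set (Fin m → ℝ)) ∧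
        μ = (equilibrium (m + 1) α : Measure (Fin m → ℝ)).withDensity φ := by
    obtain ⟨hprob, φ, -, hφ, hμφ⟩ := hμ
    exact ⟨hprob, φ, hφ, hμφ⟩
  have hN : (0 : ℝ) ≤ ((m + 1 : ℕ) : ℝ) := by positivity
  -- Since `φ` is monotone only on `Omega`, it is first extended to the whole space by its supremum
  -- over smaller points of `Omega`.
  have hΦ : Monotone fun x : Fin m → ℝ =>
      ⨆ z : {z : Fin m → ℝ // z ∈ (Omega (m + 1) : Set (Fin m → ℝ)) ∧ z ≤ x}, φ z.1 := by
    intro x y hxy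
    exact iSup_le fun z => le_iSup (fun z : {z : Fin m → ℝ //
      z ∈ (Omega (m + 1) : Set (Fin m → ℝ)) ∧ z ≤ y} => φ z.1) ⟨z, z.2.1, z.2.2.trans hxy⟩
  have hΦφ : ∀ x ∈ (Omega (m + 1) : Set (Fin m → ℝ)),
      ⨆ z : {z : Fin m → ℝ // z ∈ (Omega (m + 1) : Set (Fin m → ℝ)) ∧ z ≤ x}, φ z.1 = φ x := by
    intro x hx
    refine le_antisymm (iSup_le fun z => hφ z.2.1 hx z.2.2) ?_
    exact le_iSup (fun z : {z : Fin m → ℝ //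
      z ∈ (Omega (m + 1) : Set (Fin m → ℝ)) ∧ z ≤ x} => φ z.1) ⟨x, hx, le_rfl⟩
  obtain ⟨ψ, hψm, hψ, hψΦ⟩ := exists_measurable_monotone_ae_eq hΦ
  have hae : φ =ᵐ[(equilibrium (m + 1) α : Measure (Fin m → ℝ))] ψ := by
    have hac : (equilibrium (m + 1) α : Measure (Fin m → ℝ)) ≪
        volume.restrict (Omega (m + 1) : Set (Fin m → ℝ)) := withDensity_absolutelyContinuous _ _
    refine hac.ae_le ?_
    have h1 := ae_restrict_of_ae (s := (Omega (m + 1) : Set (Fin m → ℝ))) hψΦ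
    filter_upwards [h1, ae_restrict_mem (measurableSet_Omega m)] with x hx hxΩ
    rw [hx, hΦφ x hxΩ]
  have hμψ : μ = (equilibrium (m + 1) α : Measure (Fin m → ℝ)).withDensity ψ :=
    hμφ.trans (withDensity_congr_ae hae)
  have hfm : Measurable fun x : Fin m → ℝ => ψ (((m + 1 : ℕ) : ℝ) • x) := by fun_prop
  have hμf : μ = ((simplexLaw α m).withDensity fun x => ψ (((m + 1 : ℕ) : ℝ) • x)).map
      fun x => ((m + 1 : ℕ) : ℝ) • x := by
    refine Measure.ext_of_lintegral _ fun G hG => ?_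
    rw [hμψ, lintegral_withDensity_eq_lintegral_mul _ hψm hG, lintegral_map hG (by fun_prop),
      lintegral_withDensity_eq_lintegral_mul _ hfm (by fun_prop)]
    exact lintegral_equilibrium m (hψm.mul hG)
  refine ⟨_, hfm, fun x y hxy => hψ (smul_le_smul_of_nonneg_left hxy hN), ?_, hμf⟩
  have hu : μ Set.univ = 1 := hprob.measure_univ
  rw [hμf, Measure.map_apply (by fun_prop) MeasurableSet.univ, Set.preimage_univ,
    withDensity_apply _ MeasurableSet.univ, Measure.restrict_univ] at hu
  exact hu

theorem integral_pos_simplexLaw {α : ℝ} (hα : 0 < α) (m k : ℕ) (hk : k ≤ m + 1) :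
    ∫ x, pos 1 x k ∂simplexLaw α m = k / (m + 1) := by
  have := isProbabilityMeasure_simplexLaw hα m
  rcases k with _ | p
  · simp
  rcases eq_or_lt_of_le hk with h | h
  · obtain rfl : p = m := by omega
    have : ∀ x : Fin p → ℝ, pos 1 x (p + 1) = 1 := fun x => pos_of_lt _ _ (by omega)
    simp only [this]
    have : (p + 1 : ℝ) ≠ 0 := by positivity
    simp [this]
  · obtain ⟨q, rfl⟩ : ∃ q, m = p + 1 + q := ⟨m - (p + 1), by omega⟩
    have := isProbabilityMeasure_simplexLaw hα p
    have := isProbabilityMeasure_simplexLaw hα q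
    have hi : Integrable (fun x : Fin (p + 1 + q) → ℝ => (1 : ℝ) * pos 1 x (p + 1))
        (simplexLaw α (p + 1 + q)) := by
      refine Integrable.of_bound (by fun_prop) 1 ?_
      filter_upwards [ae_pos_mem_Icc_simplexLaw α (p + 1 + q)] with x hx
      have := hx (p + 1) (by omega)
      rw [one_mul, Real.norm_eq_abs, abs_of_nonneg this.1]
      exact this.2
    obtain ⟨-, e⟩ := integral_simplexLaw_split hα p q (F := fun _ => 1)
      (H := fun x => pos 1 x (p + 1)) (h := fun z => z.1) measurable_const (by fun_prop)
      (fun b v w => by rw [pos_glue_left _ _ _ le_rfl, pos_of_lt _ _ (by omega), mul_one]) hi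
    simp only [one_mul, integral_const, probReal_univ, smul_eq_mul] at e
    rw [e, integral_id_betaMeasure (by positivity) (by positivity)]
    push_cast
    field_simp
    ring

/-! ### From covariances to differences of probabilities. -/

theorem tendsto_integral_truncation {X : Type*} [MeasurableSpace X] {D : Measure X}
    {f : X → ENNReal} (hf : Measurable f) (hf1 : ∫⁻ x, f x ∂D = 1) {h : X → ℝ}
    (hh : Measurable h) {C : ℝ} (hC : ∀ᵐ x ∂D, |h x| ≤ C) :
    Tendsto (fun n : ℕ => ∫ x, (min (f x) n).toReal * h x ∂D) atTop
      (𝓝 (∫ x, h x ∂D.withDensity f)) := by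
  have hfin : ∀ᵐ x ∂D, f x < ⊤ := ae_lt_top hf (by rw [hf1]; exact ENNReal.one_ne_top)
  rw [integral_withDensity_eq_integral_toReal_smul hf hfin]
  have hfi : Integrable (fun x => (f x).toReal) D :=
    integrable_toReal_of_lintegral_ne_top hf.aemeasurable (by rw [hf1]; exact ENNReal.one_ne_top)
  refine tendsto_integral_of_dominated_convergence (fun x => (f x).toReal * C)
    (fun n => by fun_prop) (hfi.mul_const C) (fun n => ?_) ?_
  · filter_upwards [hC, hfin] with x hx hfx
    rw [norm_mul, Real.norm_eq_abs, Real.norm_eq_abs, abs_of_nonneg ENNReal.toReal_nonneg]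
    gcongr
    · exact hfx.ne
    · exact min_le_left _ _
  · filter_upwards [hfin] with x hfx
    obtain ⟨n₀, hn₀⟩ := ENNReal.exists_nat_gt hfx.ne
    refine tendsto_const_nhds.congr' ?_
    filter_upwards [eventually_ge_atTop n₀] with n hn
    have : f x ≤ n := hn₀.le.trans (by exact_mod_cast hn)
    rw [min_eq_left this, smul_eq_mul]

/-- A covariance bound controls the total variation distance on the labelled points. -/
theorem CovarianceBound.real_sub_le {α : ℝ} (hα : 0 < α) {u : ℕ → ℕ} {k m : ℕ} {A B : ℝ}
    (hu : ∀ i < k, u i ≤ m + 1) (h : CovarianceBound α u k m A B) {f : (Fin m → ℝ) → ENNReal}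
    (hfm : Measurable f) (hf : Monotone f) (hf1 : ∫⁻ x, f x ∂simplexLaw α m = 1)
    {S : Set (Fin m → ℝ)} (hS : MeasurableSet S)
    (hSu : ∀ x y, (∀ i < k, pos 1 x (u i) = pos 1 y (u i)) → (x ∈ S ↔ y ∈ S)) :
    ((simplexLaw α m).withDensity f).real S - (simplexLaw α m).real S ≤
      A * (∫ x, height u k x ∂(simplexLaw α m).withDensity f -
        ∫ x, height u k x ∂simplexLaw α m) + B := by
  have := isProbabilityMeasure_simplexLaw hα m
  have hprob : ((simplexLaw α m).withDensity f).real Set.univ = 1 := by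
    rw [measureReal_def, withDensity_apply _ MeasurableSet.univ, Measure.restrict_univ, hf1]
    simp
  set g : (Fin m → ℝ) → ℝ := S.indicator fun _ => 1 with hg
  have hgm : Measurable g := measurable_const.indicator hS
  have hg0 : ∀ x, 0 ≤ g x := fun x => Set.indicator_nonneg (by simp) _
  have hg1 : ∀ x, g x ≤ 1 := fun x => Set.indicator_le_self' (by simp) x
  have hgu : ∀ x y, (∀ i < k, pos 1 x (u i) = pos 1 y (u i)) → g x = g y := fun x y hxy => by
    by_cases hx : x ∈ S
    · simp [hg, hx, (hSu x y hxy).1 hx]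
    · have hy : y ∉ S := fun hy => hx ((hSu x y hxy).2 hy)
      simp [hg, hx, hy]
  have t1 := tendsto_integral_truncation hfm hf1 (h := fun _ => 1) measurable_const (C := 1)
    (by simp)
  have t2 := tendsto_integral_truncation hfm hf1 hgm (C := 1)
    (Eventually.of_forall fun x => by rw [abs_of_nonneg (hg0 x)]; exact hg1 x)
  have t3 := tendsto_integral_truncation hfm hf1 (measurable_height u k m) (C := k) (by
    filter_upwards [ae_height_mem_Icc α hu] with x hx
    rw [abs_of_nonneg hx.1]
    exact hx.2)
  have e1 : ∫ x, g x ∂(simplexLaw α m).withDensity f =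
      ((simplexLaw α m).withDensity f).real S := by
    rw [hg, integral_indicator_const _ hS]
    simp
  have e2 : ∫ x, g x ∂simplexLaw α m = (simplexLaw α m).real S := by
    rw [hg, integral_indicator_const _ hS]
    simp
  simp only [mul_one, integral_const, hprob, smul_eq_mul] at t1
  rw [e1] at t2
  -- Truncation at `n` keeps `f` increasing and makes it bounded and finite. Its total mass is only
  -- asymptotically one, which is why the bound carries the factor `∫ F`.
  have key := fun n : ℕ => (h (fun x => (min (f x) n).toReal) (by fun_prop)
    (fun x y hxy => ENNReal.toReal_mono (ne_top_of_le_ne_top (ENNReal.natCast_ne_top n)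
      (min_le_right _ _)) (min_le_min_right _ (hf hxy)))
    (fun x => ENNReal.toReal_nonneg) n (fun x => ENNReal.toReal_le_of_le_ofReal (by positivity)
      (by simp)) g hgm hg0 hg1 hgu).2
  rw [e2] at key
  have := le_of_tendsto_of_tendsto' (t2.sub (t1.mul_const _))
    (((t3.sub (t1.mul_const _)).const_mul A).add (t1.const_mul B)) key
  simpa using this

/-! ### Spacing of the special labels and choice of constants. -/

/-- The spacing is at least both `1` and `⌊N/K⌋`, so twice it is at least `⌊N/K⌋ + 1 > N/K`. Thus
both beta parameters at each split are comparable to `N α`, even for `N < K`. -/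
theorem le_mul_specialLabel_sub {N K k : ℕ} (hK : 1 ≤ K)
    (h : specialLabel N K k < specialLabel N K (k + 1)) :
    N ≤ 2 * K * (specialLabel N K (k + 1) - specialLabel N K k) := by
  have h1 : k * N / K + N / K ≤ (k + 1) * N / K := by
    rw [add_mul, one_mul]
    exact Nat.div_add_div_le_add_div
  have h2 : N < K * (N / K + 1) := by
    have := Nat.lt_div_mul_add (a := N) hK
    nlinarith
  unfold specialLabel at *
  have h3 : N / K ≤ (k + 1) * N / K - k * N / K := by omega
  have h4 : 1 ≤ (k + 1) * N / K - k * N / K := by omega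
  calc N ≤ K * (N / K + 1) := h2.le
    _ ≤ K * (2 * ((k + 1) * N / K - k * N / K)) := by
      gcongr
      omega
    _ = _ := by ring

theorem monotone_specialLabel (N K : ℕ) : Monotone (specialLabel N K) := fun i j hij => by
  unfold specialLabel
  gcongr

theorem specialLabel_zero (N K : ℕ) : specialLabel N K 0 = 0 := by simp [specialLabel]

theorem specialLabel_self (N : ℕ) {K : ℕ} (hK : 1 ≤ K) : specialLabel N K K = N := by
  rw [specialLabel, Nat.mul_div_cancel_left _ hK]

theorem le_mul_specialLabel {N K k : ℕ} (hK : 1 ≤ K) (h : 0 < specialLabel N K k) :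
    N ≤ 2 * K * specialLabel N K k := by
  induction k with
  | zero => simp [specialLabel] at h
  | succ k ih =>
    rcases eq_or_lt_of_le (monotone_specialLabel N K (Nat.le_succ k)) with he | hl
    · rw [← he] at h ⊢
      exact ih h
    · exact (le_mul_specialLabel_sub hK hl).trans (Nat.mul_le_mul_left _ (Nat.sub_le _ _))

theorem specialHeight_smul {m K : ℕ} (hK : 1 ≤ K) (x : Fin m → ℝ) :
    specialHeight (m + 1) K (((m + 1 : ℕ) : ℝ) • x : Fin m → ℝ) =
      ((m + 1 : ℕ) : ℝ) * height (specialLabel (m + 1) K) K x -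
        ∑ i ∈ Finset.range K, (specialLabel (m + 1) K i : ℝ) := by
  have h1 : ∀ k, pos ((m + 1 : ℕ) : ℝ) (((m + 1 : ℕ) : ℝ) • x) k = ((m + 1 : ℕ) : ℝ) * pos 1 x k :=
    fun k => by rw [← pos_smul, mul_one]
  obtain ⟨K, rfl⟩ : ∃ k, K = k + 1 := ⟨K - 1, by omega⟩
  have h2 : Finset.Icc 1 K = Finset.Ico 1 (K + 1) := by
    ext i
    simp only [Finset.mem_Icc, Finset.mem_Ico]
    omega
  unfold specialHeight height
  rw [Finset.mul_sum, ← Finset.sum_sub_distrib, Nat.add_sub_cancel, h2,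
    Finset.range_eq_Ico, Finset.sum_eq_sum_Ico_succ_bot (Nat.succ_pos K)]
  simp only [position_eq_pos, h1, specialLabel_zero, pos_zero]
  simp

theorem measurable_specialPositions (m K : ℕ) :
    Measurable (specialPositions (m + 1) K : (Fin m → ℝ) → Fin (K - 1) → ℝ) := by
  refine measurable_pi_iff.2 fun i => ?_
  simp only [specialPositions, position_eq_pos]
  fun_prop

theorem measurable_specialHeight (m K : ℕ) :
    Measurable (specialHeight (m + 1) K : (Fin m → ℝ) → ℝ) := by
  unfold specialHeight
  simp only [position_eq_pos]
  fun_prop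

theorem covarianceBound_specialLabel {α : ℝ} (hα : 1 ≤ α) {K : ℕ} (hK : 1 ≤ K) {r : ℝ}
    (hr : 0 < r) : ∃ C : ℝ, 0 ≤ C ∧ ∀ m : ℕ,
      CovarianceBound α (specialLabel (m + 1) K) K m (C * Real.sqrt ((m + 1 : ℕ) : ℝ)) (K * r) := by
  have hα0 : 0 < α := by positivity
  have hK0 : (0 : ℝ) < K := by positivity
  -- The beta law of a split point gives `[0, c)` mass at most `2(s + t)/s · √c`, and `(s + t)/s ≤
  -- 2K`.
  set c : ℝ := min 1 ((r / (4 * K)) ^ 2) with hc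
  have hc0 : 0 < c := lt_min one_pos (by positivity)
  set t : ℝ := 1 / (2 * K) with ht
  have ht0 : 0 < t := by positivity
  -- Chosen so that `4 d₀ / √n = t³ / (12 √(n α))`, the lower bound for the mean absolute deviation
  -- when both parameters have share at least `t`.
  set d₀ : ℝ := t ^ 3 / (48 * Real.sqrt α) with hd₀
  have hsα : 0 < Real.sqrt α := Real.sqrt_pos.2 hα0
  have hd₀0 : 0 < d₀ := by positivity
  refine ⟨covarianceConst c 1 K / d₀, div_nonneg (covarianceConst_nonneg hc0 one_pos K) hd₀0.le,
    fun m => ?_⟩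
  set n : ℝ := ((m + 1 : ℕ) : ℝ) with hn
  have hn0 : 0 < n := by positivity
  have hsn : 0 < Real.sqrt n := Real.sqrt_pos.2 hn0
  have hd : 0 < d₀ / Real.sqrt n := by positivity
  have e : covarianceConst c 1 K / d₀ * Real.sqrt n = covarianceConst c (d₀ / Real.sqrt n) K := by
    rw [covarianceConst_eq c (d₀ / Real.sqrt n)]
    field_simp
  rw [e]
  refine covarianceBound_of_beta hα0 (monotone_specialLabel _ _) hc0 (min_le_left _ _) hd hr.le
    (specialLabel_zero _ _) (fun k hk p q hp hq => ?_) K le_rfl m (specialLabel_self _ hK)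
  have h1 := le_mul_specialLabel hK (hp ▸ Nat.succ_pos p : 0 < specialLabel (m + 1) K k)
  have h2 := le_mul_specialLabel_sub (N := m + 1) (k := k) hK (by omega)
  have h3 : specialLabel (m + 1) K (k + 1) ≤ m + 1 := by
    have := monotone_specialLabel (m + 1) K (Nat.succ_le_of_lt hk)
    rwa [specialLabel_self _ hK] at this
  rw [hp] at h1
  rw [hp, hq, show p + 1 + q + 1 - (p + 1) = q + 1 by omega] at h2
  rw [hq] at h3
  have h1' : n ≤ 2 * K * (p + 1) := by rw [hn]; exact_mod_cast h1
  have h2' : n ≤ 2 * K * (q + 1) := by rw [hn]; exact_mod_cast h2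
  have h3' : (p + 1 + (q + 1) : ℝ) ≤ n := by rw [hn]; exact_mod_cast h3
  have hp1 : 1 ≤ (p + 1) * α := by nlinarith [(Nat.cast_nonneg p : (0 : ℝ) ≤ p)]
  have hq1 : 1 ≤ (q + 1) * α := by nlinarith [(Nat.cast_nonneg q : (0 : ℝ) ≤ q)]
  have hsum : (p + 1) * α + (q + 1) * α ≤ n * α := by nlinarith
  have hnp : n * α ≤ 2 * K * ((p + 1) * α) := by nlinarith
  have hnq : n * α ≤ 2 * K * ((q + 1) * α) := by nlinarith
  constructor
  · refine le_trans ?_ (integral_abs_sub_betaMeasure_ge hp1 hq1 ht0 ?_ ?_)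
    · calc 4 * (d₀ / Real.sqrt n) = t ^ 3 / (12 * Real.sqrt (n * α)) := by
            rw [hd₀, Real.sqrt_mul hn0.le]
            field_simp
            norm_num
        _ ≤ _ := by gcongr
    · rw [ht, one_div_mul_eq_div, div_le_iff₀ (by positivity)]
      linarith
    · rw [ht, one_div_mul_eq_div, div_le_iff₀ (by positivity)]
      linarith
  · refine (betaMeasure_real_Iio_le hp1 (by positivity)).trans ?_
    have hsc : Real.sqrt c ≤ r / (4 * K) := by
      calc Real.sqrt c ≤ Real.sqrt ((r / (4 * K)) ^ 2) := Real.sqrt_le_sqrt (min_le_right _ _)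
        _ = _ := Real.sqrt_sq (by positivity)
    calc 2 * ((p + 1) * α + (q + 1) * α) / ((p + 1) * α) * Real.sqrt c
        ≤ (4 * K) * (r / (4 * K)) := by
          gcongr
          rw [div_le_iff₀ (by positivity)]
          linarith
      _ = r := by field_simp

/-! ### Conclusion in total variation. -/

theorem tvDist_specialMarginal_le {α : ℝ} (hα : 0 < α) {K m : ℕ} (hK : 1 ≤ K) {A B τ : ℝ}
    (hA : 0 ≤ A) (h : CovarianceBound α (specialLabel (m + 1) K) K m A B)
    {μ : Measure (Fin m → ℝ)} (hμ : μ ∈ IncreasingDensity (m + 1) α)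
    (hW : ∫ x, specialHeight (m + 1) K x ∂μ ≤ ((m + 1 : ℕ) : ℝ) * τ) :
    tvDist (specialMarginal (m + 1) K μ) (specialMarginal (m + 1) K (equilibrium (m + 1) α)) ≤
      A * τ + B := by
  have hprob := isProbabilityMeasure_simplexLaw hα m
  obtain ⟨f, hfm, hf, hf1, hμf⟩ := exists_density_simplexLaw hμ
  set D := simplexLaw α m with hD
  set n : ℝ := ((m + 1 : ℕ) : ℝ) with hn
  have hn0 : 0 < n := by positivity
  set u := specialLabel (m + 1) K with hu
  have hul : ∀ i < K, u i ≤ m + 1 := fun i hi => by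
    have := monotone_specialLabel (m + 1) K hi.le
    rwa [specialLabel_self _ hK] at this
  have hsm : Measurable fun x : Fin m → ℝ => n • x := by fun_prop
  have hac : D.withDensity f ≪ D := withDensity_absolutelyContinuous _ _
  have hprob' : IsProbabilityMeasure (D.withDensity f) := ⟨by
    rw [withDensity_apply _ MeasurableSet.univ, Measure.restrict_univ, hf1]⟩
  have hhi : Integrable (height u K) (D.withDensity f) := by
    refine Integrable.of_bound (measurable_height u K m).aestronglyMeasurable K ?_
    filter_upwards [hac.ae_le (ae_height_mem_Icc α hul)] with x hx
    rw [Real.norm_eq_abs, abs_of_nonneg hx.1]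
    exact hx.2
  have hmean : ∫ x, height u K x ∂D = (∑ i ∈ Finset.range K, (u i : ℝ)) / n := by
    have hi : ∀ i ∈ Finset.range K, Integrable (fun x : Fin m → ℝ => pos 1 x (u i)) D := by
      intro i hi
      refine Integrable.of_bound (measurable_pos _ _ _).aestronglyMeasurable 1 ?_
      filter_upwards [ae_pos_mem_Icc_simplexLaw α m] with x hx
      have := hx (u i) (hul i (Finset.mem_range.1 hi))
      rw [Real.norm_eq_abs, abs_of_nonneg this.1]
      exact this.2
    unfold height
    rw [integral_finsetSum _ hi, Finset.sum_div]
    refine Finset.sum_congr rfl fun i hi => ?_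
    rw [integral_pos_simplexLaw hα m _ (hul i (Finset.mem_range.1 hi)), hn]
    push_cast
    rfl
  have hWD : ∫ x, height u K x ∂D.withDensity f - ∫ x, height u K x ∂D ≤ τ := by
    have e : ∫ x, specialHeight (m + 1) K x ∂μ =
        n * ∫ x, height u K x ∂D.withDensity f - ∑ i ∈ Finset.range K, (u i : ℝ) := by
      rw [hμf]
      refine (integral_map hsm.aemeasurable
        (measurable_specialHeight m K).aestronglyMeasurable).trans ?_
      simp only [hn, specialHeight_smul hK]
      rw [integral_sub (hhi.const_mul _) (integrable_const _), integral_const_mul]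
      simp [hu]
    rw [e] at hW
    rw [hmean, ← mul_le_mul_iff_right₀ hn0, mul_sub, mul_div_cancel₀ _ hn0.ne']
    exact hW
  refine ciSup_le fun E' => ?_
  obtain ⟨E, hE⟩ := E'
  dsimp only
  have hpre : ∀ ν : Measure (Fin m → ℝ), (specialMarginal (m + 1) K (ν.map fun x => n • x)).real E =
      ν.real ((fun x => specialPositions (m + 1) K (n • x : Fin m → ℝ)) ⁻¹' E) := fun ν => by
    have h1 : specialMarginal (m + 1) K (ν.map fun x => n • x) =
        ν.map fun x => specialPositions (m + 1) K (n • x : Fin m → ℝ) :=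
      Measure.map_map (measurable_specialPositions m K) hsm
    rw [h1]
    exact map_measureReal_apply ((measurable_specialPositions m K).comp hsm) hE
  have heq : specialMarginal (m + 1) K (equilibrium (m + 1) α) =
      specialMarginal (m + 1) K (D.map fun x => n • x) :=
    congrArg _ (equilibrium_eq_map m)
  rw [heq, hμf]
  refine (congrArg₂ (· - ·) (hpre (D.withDensity f)) (hpre D)).le.trans ?_
  have hS : MeasurableSet ((fun x => specialPositions (m + 1) K (n • x : Fin m → ℝ)) ⁻¹' E) :=
    ((measurable_specialPositions m K).comp hsm) hE
  refine (h.real_sub_le hα hul hfm hf hf1 hS fun x y hxy => ?_).trans (by gcongr)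
  have : specialPositions (m + 1) K (n • x : Fin m → ℝ) =
      specialPositions (m + 1) K (n • y : Fin m → ℝ) := by
    ext i
    have h1 : ∀ z : Fin m → ℝ, ∀ k, pos n (n • z) k = n * pos 1 z k :=
      fun z k => by rw [← pos_smul, mul_one]
    have := i.2
    change pos n (n • x) (u (i + 1)) = pos n (n • y) (u (i + 1))
    rw [h1, h1, hxy (i + 1) (by omega)]
  simp only [Set.mem_preimage, this]

theorem exists_tvDist_specialMarginal_le {α : ℝ} (hα : 1 ≤ α) {K : ℕ} (hK : 1 ≤ K) {ε : ℝ}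
    (hε : 0 < ε) :
    ∃ η : ℝ, 0 < η ∧ ∀ N : ℕ, 2 ≤ N → ∀ μ ∈ IncreasingDensity N α,
      ∫ x, specialHeight N K x ∂μ ≤ η * Real.sqrt N →
        tvDist (specialMarginal N K μ) (specialMarginal N K (equilibrium N α)) ≤ ε := by
  have hα0 : 0 < α := by positivity
  have hK0 : (0 : ℝ) < K := by positivity
  obtain ⟨C, hC, hcov⟩ := covarianceBound_specialLabel hα hK (r := ε / (2 * K)) (by positivity)
  -- The `K` splits cost at most `K r = ε/2`, and the height term is `C η ≤ ε/2`; the `+ 1` allows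
  -- for `C = 0`.
  refine ⟨ε / (2 * (C + 1)), by positivity, fun N hN μ hμ hW => ?_⟩
  obtain ⟨m, rfl⟩ : ∃ m, N = m + 1 := ⟨N - 1, by omega⟩
  have hn0 : (0 : ℝ) < ((m + 1 : ℕ) : ℝ) := by positivity
  have hs0 : 0 < Real.sqrt ((m + 1 : ℕ) : ℝ) := Real.sqrt_pos.2 hn0
  have hsq : Real.sqrt ((m + 1 : ℕ) : ℝ) ^ 2 = ((m + 1 : ℕ) : ℝ) := Real.sq_sqrt hn0.le
  refine (tvDist_specialMarginal_le hα0 hK (by positivity) (hcov m) hμ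
    (τ := ε / (2 * (C + 1)) / Real.sqrt ((m + 1 : ℕ) : ℝ)) (hW.trans_eq ?_)).trans ?_
  · rw [mul_div_assoc', eq_div_iff hs0.ne', mul_assoc, ← sq, hsq, mul_comm]
  · have h1 : C * Real.sqrt ((m + 1 : ℕ) : ℝ) *
        (ε / (2 * (C + 1)) / Real.sqrt ((m + 1 : ℕ) : ℝ)) = C / (C + 1) * (ε / 2) := by
      field_simp
    have h2 : (K : ℝ) * (ε / (2 * K)) = ε / 2 := by field_simp
    have h3 : C / (C + 1) ≤ 1 := (div_le_one (by positivity)).2 (by linarith)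
    rw [h1, h2]
    nlinarith

end SimplexWalk

theorem proposition6p6 (α : ℝ) (hα : 1 ≤ α) (K : ℕ) (hK : 1 ≤ K) (ε : ℝ) (hε : 0 < ε) :
    ∃ η : ℝ, 0 < η ∧ ∀ N : ℕ, 2 ≤ N → ∀ μ ∈ SimplexWalk.IncreasingDensity N α,
      ∫ x, SimplexWalk.specialHeight N K x ∂μ ≤ η * Real.sqrt N →
        SimplexWalk.tvDist (SimplexWalk.specialMarginal N K μ)
          (SimplexWalk.specialMarginal N K (SimplexWalk.equilibrium N α)) ≤ ε :=
  SimplexWalk.exists_tvDist_specialMarginal_le hα hK hε
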